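/- Let $(\bar M,\bar g)$ be a Lorentzian manifold with Levi-Civita connection $\bar\nabla$, let $M$ be a null hypersurface of $\bar M$, i.e. an immersed manifold of codimension one together with a nowhere vanishing smooth vector field on $M$ that is $\bar g$-orthogonal to $TM$ (so that the radical $\mathrm{rad}(TM)=TM\cap TM^\perp$ is a line bundle), and let $S(TM)$ be a screen distribution, i.e. a smooth subbundle with $TM=S(TM)\oplus \mathrm{rad}(TM)$. Assume that $S(TM)$ is integrable. Let $Z$ be a smooth section of $T\bar M$ along $M$ which is closed conformal: there is a smooth function $\varphi$ on $M$ with $\bar\nabla_XZ=\varphi X$ for all $X$ tangent to $M$ (for instance the restriction to $M$ of a closed conformal vector field of $\bar M$). Let $Z^*\in\Gamma(S(TM))$ be the orthogonal projection of $Z$ to $S(TM)$, put $Z^\perp=Z-Z^*$, and for $X\in S(TM)$ let $A_{Z^\perp}X$ be minus the $S(TM)$-component of $\bar\nabla_XZ^\perp$. A null frame is a pair $\{\xi,N\}$, where $\xi$ is a smooth section of $\mathrm{rad}(TM)$ and $N$ is a smooth section of $T\bar M$ along $M$, with $\bar g(\xi,N)=1$, $\bar g(N,N)=0$ and $\bar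 g(N,X)=0$ for all $X\in S(TM)$. A smooth function $f$ on $M$ is called constant across $Z^*$ if $X\cdot f=0$ for all $X\in S(TM)$ with $\bar g(X,Z^*)=0$. Consider the following statements: 1. $Z$ gives a canonical principal direction for $A_{Z^\perp}$: at every point of $M$, $A_{Z^\perp}Z^*$ is a real multiple of $Z^*$; 2. for every null frame $\{\xi,N\}$, the product $\bar g(Z,\xi)\,\bar g(Z,N)$ (which does not depend on the frame) is constant across $Z^*$; 3. there is a null frame $\{\xi,N\}$ such that $\bar g(Z,\xi)$ and $\bar g(Z,N)$ are both constant across $Z^*$; 4. $\bar g(Z^*,Z^*)$ is constant across $Z^*$. Then (1), (2) and (4) are equivalent, and (3) implies them. If moreover, for some null frame, $\bar g(Z,\xi)$ vanishes nowhere on $M$ (that is, $Z$ is nowhere tangent to $M$) or $\bar g(Z,N)$ vanishes nowhere on $M$, then all four statements are equivalent. -/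

import Mathlib

open Set Bundle Topology
open scoped Manifold ContDiff

noncomputable section

namespace NullHyp

/-- A smooth Lorentzian metric on a manifold `B` modelled on `E`: a smooth field of symmetric
bilinear forms such that every tangent space contains a timelike vector on whose orthogonal
complement the form is positive definite. -/
structure LorentzianMetric (E : Type*) [NormedAddCommGroup E] [NormedSpace ℝ E]
    (B : Type*) [TopologicalSpace B] [ChartedSpace E B] [IsManifold 𝓘(ℝ, E) ∞ B] where
  /-- the scalar product on each tangent space -/
  inner : ∀ x : B, TangentSpace 𝓘(ℝ, E) x →L[ℝ] TangentSpace 𝓘(ℝ, E) x →L[ℝ] ℝ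
  symm : ∀ (x : B) (v w : TangentSpace 𝓘(ℝ, E) x), inner x v w = inner x w v
  lorentzian : ∀ x : B, ∃ v : TangentSpace 𝓘(ℝ, E) x, inner x v v < 0 ∧
    ∀ w : TangentSpace 𝓘(ℝ, E) x, w ≠ 0 → inner x v w = 0 → 0 < inner x w w
  contMDiff : ContMDiff 𝓘(ℝ, E) (𝓘(ℝ, E).prod 𝓘(ℝ, E →L[ℝ] E →L[ℝ] ℝ)) ∞
    (fun x ↦ TotalSpace.mk' (E →L[ℝ] E →L[ℝ] ℝ)
      (E := fun x : B ↦ TangentSpace 𝓘(ℝ, E) x →L[ℝ] TangentSpace 𝓘(ℝ, E) x →L[ℝ] ℝ) x (inner x))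

section LeviCivita

variable {E : Type*} [NormedAddCommGroup E] [NormedSpace ℝ E]
  {B : Type*} [TopologicalSpace B] [ChartedSpace E B] [IsManifold 𝓘(ℝ, E) ∞ B]
  {F : Type*} [NormedAddCommGroup F] [NormedSpace ℝ F]
  {M : Type*} [TopologicalSpace M] [ChartedSpace F M]

/-- The matrix of the metric, as a function on the model space, in the preferred chart around `q`
and the associated frame of coordinate vector fields. -/
def LorentzianMetric.inChart (g : LorentzianMetric E B) (q : B) (y : E) : E →L[ℝ] E →L[ℝ] ℝ :=
  let x : B := (extChartAt 𝓘(ℝ, E) q).symm y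
  let T : E →L[ℝ] TangentSpace 𝓘(ℝ, E) x :=
    (trivializationAt E (TangentSpace 𝓘(ℝ, E)) q).symmL ℝ x
  (ContinuousLinearMap.precomp ℝ T).comp ((g.inner x).comp T)

/-- The Christoffel symbols of the metric at `q`, in the preferred chart around `q`: with `D` the
derivative at `q` of the metric in this chart, `Γ(u, v)` is the vector with
`⟨Γ(u, v), w⟩ = (D u (v, w) + D v (u, w) - D w (u, v)) / 2` for all `w`.
(The metric is nondegenerate, so that `ContinuousLinearMap.inverse` is a true inverse when the
dimension is finite.) -/
def LorentzianMetric.christoffel (g : LorentzianMetric E B) (q : B)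
    (u v : TangentSpace 𝓘(ℝ, E) q) : TangentSpace 𝓘(ℝ, E) q :=
  let D := fderiv ℝ (g.inChart q) (extChartAt 𝓘(ℝ, E) q q)
  let G : E →L[ℝ] E →L[ℝ] ℝ := g.inner q
  let a : E := u
  let b : E := v
  let K : E →L[ℝ] ℝ := D a b + D b a - (D.flip a).flip b
  G.inverse ((1 / 2 : ℝ) • K)

/-- A field `V` of ambient tangent vectors along a map `i : M → B`, near `p`, written in the
coordinate frame of the preferred chart around `i p`. -/
def inFrame (i : M → B) (V : ∀ x : M, TangentSpace 𝓘(ℝ, E) (i x)) (p x : M) : E :=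
  (trivializationAt E (TangentSpace 𝓘(ℝ, E)) (i p)
    (⟨i x, V x⟩ : TangentBundle 𝓘(ℝ, E) B)).2

/-- The covariant derivative at `p`, for the Levi-Civita connection of `g`, of the field `V` along
the map `i`, in the direction `u` tangent to `M`: in coordinates,
`(∇_u V)ᵏ = u(Vᵏ) + Γᵏₗₘ (di u)ˡ Vᵐ`. For `i = id` this is the Levi-Civita connection. -/
def LorentzianMetric.nabla (g : LorentzianMetric E B) (i : M → B)
    (V : ∀ x : M, TangentSpace 𝓘(ℝ, E) (i x)) (p : M) (u : TangentSpace 𝓘(ℝ, F) p) :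
    TangentSpace 𝓘(ℝ, E) (i p) :=
  let d : E := mfderiv 𝓘(ℝ, F) 𝓘(ℝ, E) (inFrame i V p) p u
  let c : E := g.christoffel (i p) (mfderiv 𝓘(ℝ, F) 𝓘(ℝ, E) i p u) (V p)
  d + c

/-- Smoothness of a field of ambient tangent vectors along a map `i : M → B`. -/
def SmoothAlong (i : M → B) (V : ∀ x : M, TangentSpace 𝓘(ℝ, E) (i x)) : Prop :=
  ContMDiff 𝓘(ℝ, F) 𝓘(ℝ, E).tangent ∞ (fun x ↦ (⟨i x, V x⟩ : TangentBundle 𝓘(ℝ, E) B))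

/-- A closed conformal vector field along `i : M → B`: a smooth field `Z` along `i` such that
`∇_X Z = φ X` for all `X` tangent to `M`, for some smooth function `φ`. For `i = id` these are the
closed conformal vector fields of `B`, and they restrict to closed conformal fields along every
smooth map. -/
def IsClosedConformal (g : LorentzianMetric E B) (i : M → B)
    (Z : ∀ x : M, TangentSpace 𝓘(ℝ, E) (i x)) : Prop :=
  SmoothAlong (F := F) i Z ∧ ∃ φ : M → ℝ, ContMDiff 𝓘(ℝ, F) 𝓘(ℝ, ℝ) ∞ φ ∧
    ∀ (p : M) (u : TangentSpace 𝓘(ℝ, F) p),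
      g.nabla i Z p u = φ p • mfderiv 𝓘(ℝ, F) 𝓘(ℝ, E) i p u

end LeviCivita

section Distributions

variable {F : Type*} [NormedAddCommGroup F] [NormedSpace ℝ F]
  {M : Type*} [TopologicalSpace M] [ChartedSpace F M] [IsManifold 𝓘(ℝ, F) ∞ M]

/-- A smooth vector subbundle of the tangent bundle: a field of subspaces that has a smooth frame
near every point. -/
def IsSmoothDistribution (S : ∀ p : M, Submodule ℝ (TangentSpace 𝓘(ℝ, F) p)) : Prop :=
  ∀ p : M, ∃ U : Set M, IsOpen U ∧ p ∈ U ∧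
    ∃ (k : ℕ) (X : Fin k → ∀ q : M, TangentSpace 𝓘(ℝ, F) q),
      (∀ a, ContMDiffOn 𝓘(ℝ, F) 𝓘(ℝ, F).tangent ∞
        (fun q ↦ (⟨q, X a q⟩ : TangentBundle 𝓘(ℝ, F) M)) U) ∧
      ∀ q ∈ U, LinearIndependent ℝ (fun a ↦ X a q) ∧
        Submodule.span ℝ (Set.range fun a ↦ X a q) = S q

/-- Integrability of a distribution: through every point there is an integral manifold, given
locally as the image of an immersion `j` of an open subset of some `ℝᵏ` whose tangent spaces are
the subspaces of the distribution. -/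
def IsIntegrable (S : ∀ p : M, Submodule ℝ (TangentSpace 𝓘(ℝ, F) p)) : Prop :=
  ∀ p : M, ∃ (k : ℕ) (W : Set (EuclideanSpace ℝ (Fin k))) (j : EuclideanSpace ℝ (Fin k) → M),
    IsOpen W ∧ ContMDiffOn 𝓘(ℝ, EuclideanSpace ℝ (Fin k)) 𝓘(ℝ, F) ∞ j W ∧ (∃ w ∈ W, j w = p) ∧
    ∀ w ∈ W, Function.Injective (mfderiv 𝓘(ℝ, EuclideanSpace ℝ (Fin k)) 𝓘(ℝ, F) j w) ∧
      ((mfderiv 𝓘(ℝ, EuclideanSpace ℝ (Fin k)) 𝓘(ℝ, F) j w).range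
        : Submodule ℝ (TangentSpace 𝓘(ℝ, F) (j w))) = S (j w)

end Distributions

section Null

variable {E : Type*} [NormedAddCommGroup E] [NormedSpace ℝ E]
  {B : Type*} [TopologicalSpace B] [ChartedSpace E B] [IsManifold 𝓘(ℝ, E) ∞ B]
  {F : Type*} [NormedAddCommGroup F] [NormedSpace ℝ F]
  {M : Type*} [TopologicalSpace M] [ChartedSpace F M] [IsManifold 𝓘(ℝ, F) ∞ M]

/-- The metric induced on `M` by a map `i : M → B`. -/
def induced (g : LorentzianMetric E B) (i : M → B) (p : M) (u w : TangentSpace 𝓘(ℝ, F) p) : ℝ :=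
  g.inner (i p) (mfderiv 𝓘(ℝ, F) 𝓘(ℝ, E) i p u) (mfderiv 𝓘(ℝ, F) 𝓘(ℝ, E) i p w)

/-- `u` lies in the radical of the induced metric at `p`. -/
def InRadical (g : LorentzianMetric E B) (i : M → B) (p : M) (u : TangentSpace 𝓘(ℝ, F) p) : Prop :=
  ∀ w : TangentSpace 𝓘(ℝ, F) p, induced g i p u w = 0

/-- The radical space of the induced metric at `p`. -/
def radical (g : LorentzianMetric E B) (i : M → B) (p : M) :
    Submodule ℝ (TangentSpace 𝓘(ℝ, F) p) where
  carrier := {u | InRadical g i p u}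
  zero_mem' := fun w ↦ by simp [induced]
  add_mem' := fun {a b} ha hb w ↦ by
    have h1 := ha w
    have h2 := hb w
    simp only [induced] at h1 h2 ⊢
    rw [map_add, map_add, add_apply, h1, h2, add_zero]
  smul_mem' := fun c a ha w ↦ by
    have h1 := ha w
    simp only [induced] at h1 ⊢
    rw [map_smul, map_smul, smul_apply, h1, smul_zero]

/-- `(M, S)` is a null hypersurface of `(B, g)` through the immersion `i`: the dimension of `M` is
one less than that of `B`, there is a nowhere vanishing smooth vector field `ξ` on `M` with values
in the radical of the induced metric, and `S` is a screen distribution, that is, a smooth subbundle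
of the tangent bundle complementary to the radical. -/
structure IsNullHypersurface (g : LorentzianMetric E B) (i : M → B)
    (S : ∀ p : M, Submodule ℝ (TangentSpace 𝓘(ℝ, F) p)) : Prop where
  smooth : ContMDiff 𝓘(ℝ, F) 𝓘(ℝ, E) ∞ i
  immersion : ∀ p : M, Function.Injective (mfderiv 𝓘(ℝ, F) 𝓘(ℝ, E) i p)
  codim_one : Module.finrank ℝ E = Module.finrank ℝ F + 1
  degenerate : ∃ ξ : ∀ p : M, TangentSpace 𝓘(ℝ, F) p,
    ContMDiff 𝓘(ℝ, F) 𝓘(ℝ, F).tangent ∞ (fun p ↦ (⟨p, ξ p⟩ : TangentBundle 𝓘(ℝ, F) M)) ∧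
    ∀ p, ξ p ≠ 0 ∧ ξ p ∈ radical g i p
  screen_smooth : IsSmoothDistribution S
  screen_compl : ∀ p : M, IsCompl (S p) (radical g i p)

/-- A null frame: a smooth section `ξ` of the radical bundle and a smooth field `N` along `M` with
`⟨ξ, N⟩ = 1`, `⟨N, N⟩ = 0` and `⟨N, X⟩ = 0` for all `X` in the screen distribution. -/
structure IsNullFrame (g : LorentzianMetric E B) (i : M → B)
    (S : ∀ p : M, Submodule ℝ (TangentSpace 𝓘(ℝ, F) p))
    (ξ : ∀ p : M, TangentSpace 𝓘(ℝ, F) p) (N : ∀ p : M, TangentSpace 𝓘(ℝ, E) (i p)) : Prop where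
  smooth_ξ : ContMDiff 𝓘(ℝ, F) 𝓘(ℝ, F).tangent ∞ (fun p ↦ (⟨p, ξ p⟩ : TangentBundle 𝓘(ℝ, F) M))
  radical_ξ : ∀ p, ξ p ∈ radical g i p
  smooth_N : SmoothAlong (F := F) i N
  inner_ξ_N : ∀ p, g.inner (i p) (mfderiv 𝓘(ℝ, F) 𝓘(ℝ, E) i p (ξ p)) (N p) = 1
  inner_N_N : ∀ p, g.inner (i p) (N p) (N p) = 0
  inner_N_screen : ∀ p, ∀ X ∈ S p, g.inner (i p) (N p) (mfderiv 𝓘(ℝ, F) 𝓘(ℝ, E) i p X) = 0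

open Classical in
/-- The orthogonal projection of an ambient vector `v` at `p` to the screen space `S p`: the vector
`u` of `S p` for which `v - u` is orthogonal to `S p`. -/
def screenPart (g : LorentzianMetric E B) (i : M → B)
    (S : ∀ p : M, Submodule ℝ (TangentSpace 𝓘(ℝ, F) p)) (p : M) (v : TangentSpace 𝓘(ℝ, E) (i p)) :
    TangentSpace 𝓘(ℝ, F) p :=
  if h : ∃ u ∈ S p, ∀ w ∈ S p,
      g.inner (i p) (v - mfderiv 𝓘(ℝ, F) 𝓘(ℝ, E) i p u) (mfderiv 𝓘(ℝ, F) 𝓘(ℝ, E) i p w) = 0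
  then h.choose else 0

/-- The component `Z - Z*` of a field `Z` along `M` that is orthogonal to the screen distribution,
`Z*` being the screen component. -/
def perpPart (g : LorentzianMetric E B) (i : M → B)
    (S : ∀ p : M, Submodule ℝ (TangentSpace 𝓘(ℝ, F) p)) (Z : ∀ p : M, TangentSpace 𝓘(ℝ, E) (i p))
    (p : M) : TangentSpace 𝓘(ℝ, E) (i p) :=
  Z p - mfderiv 𝓘(ℝ, F) 𝓘(ℝ, E) i p (screenPart g i S p (Z p))

/-- The shape operator `A_V` of the screen distribution for a field `V` orthogonal to it: `A_V X` is
minus the screen component of `∇_X V`. -/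
def shapeOperator (g : LorentzianMetric E B) (i : M → B)
    (S : ∀ p : M, Submodule ℝ (TangentSpace 𝓘(ℝ, F) p)) (V : ∀ p : M, TangentSpace 𝓘(ℝ, E) (i p))
    (p : M) (X : TangentSpace 𝓘(ℝ, F) p) : TangentSpace 𝓘(ℝ, F) p :=
  -screenPart g i S p (g.nabla i V p X)

/-- `Z` gives a canonical principal direction for `A_{Z^⊥}`: at every point, `A_{Z^⊥} Z*` is a
multiple of `Z*`. -/
def HasCanonicalPrincipalDirection (g : LorentzianMetric E B) (i : M → B)
    (S : ∀ p : M, Submodule ℝ (TangentSpace 𝓘(ℝ, F) p))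
    (Z : ∀ p : M, TangentSpace 𝓘(ℝ, E) (i p)) : Prop :=
  ∀ p : M, ∃ c : ℝ, shapeOperator g i S (perpPart g i S Z) p (screenPart g i S p (Z p)) =
    c • screenPart g i S p (Z p)

/-- The function `f` on `M` is constant in the directions tangent to the screen distribution and
orthogonal to the screen component of `Z`: its derivative vanishes in these directions. -/
def ConstantAcross (g : LorentzianMetric E B) (i : M → B)
    (S : ∀ p : M, Submodule ℝ (TangentSpace 𝓘(ℝ, F) p))
    (Z : ∀ p : M, TangentSpace 𝓘(ℝ, E) (i p)) (f : M → ℝ) : Prop :=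
  ∀ (p : M), ∀ X ∈ S p, induced g i p X (screenPart g i S p (Z p)) = 0 →
    mfderiv 𝓘(ℝ, F) 𝓘(ℝ, ℝ) f p X = 0

/-- The function `⟨Z, ξ⟩` on `M`, for a vector field `ξ` on `M`. -/
def innerTangent (g : LorentzianMetric E B) (i : M → B) (Z : ∀ p : M, TangentSpace 𝓘(ℝ, E) (i p))
    (ξ : ∀ p : M, TangentSpace 𝓘(ℝ, F) p) (p : M) : ℝ :=
  g.inner (i p) (Z p) (mfderiv 𝓘(ℝ, F) 𝓘(ℝ, E) i p (ξ p))

/-- The function `⟨Z, N⟩` on `M`, for a field `N` along `M`. -/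
def innerAlong (g : LorentzianMetric E B) (i : M → B)
    (Z N : ∀ p : M, TangentSpace 𝓘(ℝ, E) (i p)) (p : M) : ℝ :=
  g.inner (i p) (Z p) (N p)

/-- The product `⟨Z, ξ⟩⟨Z, N⟩` (which does not depend on the null frame) is constant in the screen
directions orthogonal to the screen component of `Z`. -/
def ProductConstant (g : LorentzianMetric E B) (i : M → B)
    (S : ∀ p : M, Submodule ℝ (TangentSpace 𝓘(ℝ, F) p))
    (Z : ∀ p : M, TangentSpace 𝓘(ℝ, E) (i p)) : Prop :=
  ∀ ξ N, IsNullFrame g i S ξ N →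
    ConstantAcross g i S Z (fun p ↦ innerTangent g i Z ξ p * innerAlong g i Z N p)

/-- For some null frame, both `⟨Z, ξ⟩` and `⟨Z, N⟩` are constant in the screen directions orthogonal
to the screen component of `Z`. -/
def FrameConstant (g : LorentzianMetric E B) (i : M → B)
    (S : ∀ p : M, Submodule ℝ (TangentSpace 𝓘(ℝ, F) p))
    (Z : ∀ p : M, TangentSpace 𝓘(ℝ, E) (i p)) : Prop :=
  ∃ ξ N, IsNullFrame g i S ξ N ∧ ConstantAcross g i S Z (innerTangent g i Z ξ) ∧
    ConstantAcross g i S Z (innerAlong g i Z N)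

/-- `⟨Z*, Z*⟩` is constant in the screen directions orthogonal to `Z*`, the screen component. -/
def NormConstant (g : LorentzianMetric E B) (i : M → B)
    (S : ∀ p : M, Submodule ℝ (TangentSpace 𝓘(ℝ, F) p))
    (Z : ∀ p : M, TangentSpace 𝓘(ℝ, E) (i p)) : Prop :=
  ConstantAcross g i S Z
    (fun p ↦ induced g i p (screenPart g i S p (Z p)) (screenPart g i S p (Z p)))

end Null

end NullHyp

end

noncomputable section

namespace NullHyp

/-! For a null frame, Z = Z* + ⟨Z,N⟩ξ + ⟨Z,ξ⟩N, hence ⟨Z,Z⟩ = ⟨Z*,Z*⟩ + 2⟨Z,ξ⟩⟨Z,N⟩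
(`IsNullHypersurface.inner_self_eq`). If X ∈ S is orthogonal to Z*, then X⟨Z,Z⟩ = 2φ⟨X,Z⟩ = 2φ⟨X,Z*⟩
= 0, so the derivatives of the two summands along X cancel. This gives (2) ⇔ (4). Null frames must
be shown to exist, since (2) quantifies over all of them and would otherwise be vacuous.

For (1) ⇔ (4), write Z* = Z - Z^⊥. For the same X, X⟨Z*,Z*⟩ = 2⟨∇_X Z*, Z*⟩ = 2φ⟨X,Z*⟩ - 2⟨∇_X Z^⊥,
Z*⟩ = 2⟨A X, Z*⟩ = 2⟨A Z*, X⟩, with A the shape operator of Z^⊥. The last equality is the symmetry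
of A, and this is where integrability of S enters (`inner_nabla_symm_of_isIntegrable`). So (4) says
that A Z* is orthogonal to everything in S orthogonal to Z*; as the metric is nondegenerate on S,
this means that A Z* is a multiple of Z*.

(3) ⇒ (2) is the Leibniz rule. Conversely, if ⟨Z,ξ⟩ has no zero, the frame ξ/⟨Z,ξ⟩, ⟨Z,ξ⟩N turns the
two functions into 1 and the product; the case of ⟨Z,N⟩ is alike.

The connection is given by Christoffel symbols in charts, so metric compatibility and the symmetry
of A are proved in coordinates. Smoothness of Z*, needed in order to differentiate it, comes from
Cramer's rule. -/

theorem eventually_mem_source (H : Type*) [TopologicalSpace H] {B : Type*} [TopologicalSpace B]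
    [ChartedSpace H B] {M : Type*} [TopologicalSpace M] {i : M → B} {p : M}
    (h : ContinuousAt i p) : ∀ᶠ x in 𝓝 p, i x ∈ (chartAt H (i p)).source :=
  h.eventually ((chartAt H (i p)).open_source.mem_nhds (mem_chart_source H (i p)))

/-! ### Fields along a map in chart coordinates -/

section LeviCivita

variable {E : Type*} [NormedAddCommGroup E] [NormedSpace ℝ E]
  {B : Type*} [TopologicalSpace B] [ChartedSpace E B] [IsManifold 𝓘(ℝ, E) ∞ B]
  {F : Type*} [NormedAddCommGroup F] [NormedSpace ℝ F]
  {M : Type*} [TopologicalSpace M] [ChartedSpace F M]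

/-- Smoothness at a point of a field of ambient tangent vectors along a map `i : M → B`. -/
def SmoothAlongAt (i : M → B) (V : ∀ x : M, TangentSpace 𝓘(ℝ, E) (i x)) (p : M) : Prop :=
  ContMDiffAt 𝓘(ℝ, F) 𝓘(ℝ, E).tangent ∞ (fun x ↦ (⟨i x, V x⟩ : TangentBundle 𝓘(ℝ, E) B)) p

/-- The coordinates of an ambient tangent vector at `b` in the preferred chart around `q`. -/
def frameMap (q b : B) : TangentSpace 𝓘(ℝ, E) b →L[ℝ] E :=
  (trivializationAt E (TangentSpace 𝓘(ℝ, E)) q).continuousLinearMapAt ℝ b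

/-- `frameMap` is linear at every point, so sums and multiples of fields can be treated termwise; it
represents the coordinates only over the chart domain. -/
theorem inFrame_eq {i : M → B} (V : ∀ x : M, TangentSpace 𝓘(ℝ, E) (i x)) {p x : M}
    (hx : i x ∈ (chartAt E (i p)).source) : inFrame i V p x = frameMap (i p) (i x) (V x) := by
  rw [frameMap, Trivialization.continuousLinearMapAt_apply, Trivialization.coe_linearMapAt_of_mem]
  · rfl
  · simpa using hx

theorem frameMap_self (q : B) (v : TangentSpace 𝓘(ℝ, E) q) : frameMap q q v = v := by
  rw [frameMap, TangentBundle.continuousLinearMapAt_trivializationAt_eq_core (mem_chart_source E q)]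
  exact (tangentBundleCore 𝓘(ℝ, E) B).coordChange_self _ _ (mem_chart_source E q) v

theorem symmL_frameMap {q b : B} (hb : b ∈ (chartAt E q).source) (v : TangentSpace 𝓘(ℝ, E) b) :
    (trivializationAt E (TangentSpace 𝓘(ℝ, E)) q).symmL ℝ b (frameMap q b v) = v :=
  Trivialization.symmL_continuousLinearMapAt _ (by simpa using hb) v

theorem inner_eq_inChart (g : LorentzianMetric E B) {q b : B} (hb : b ∈ (chartAt E q).source)
    (v w : TangentSpace 𝓘(ℝ, E) b) :
    g.inner b v w = g.inChart q (extChartAt 𝓘(ℝ, E) q b) (frameMap q b v) (frameMap q b w) := by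
  have h : (extChartAt 𝓘(ℝ, E) q).symm (extChartAt 𝓘(ℝ, E) q b) = b :=
    (extChartAt 𝓘(ℝ, E) q).left_inv (by simpa using hb)
  simp only [LorentzianMetric.inChart]
  rw [h]
  change _ = g.inner b ((trivializationAt E (TangentSpace 𝓘(ℝ, E)) q).symmL ℝ b (frameMap q b v))
    ((trivializationAt E (TangentSpace 𝓘(ℝ, E)) q).symmL ℝ b (frameMap q b w))
  rw [symmL_frameMap hb, symmL_frameMap hb]

theorem inChart_self (g : LorentzianMetric E B) (q : B) (v w : TangentSpace 𝓘(ℝ, E) q) :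
    g.inChart q (extChartAt 𝓘(ℝ, E) q q) v w = g.inner q v w := by
  rw [inner_eq_inChart g (mem_chart_source E q), frameMap_self, frameMap_self]

theorem inChart_symm (g : LorentzianMetric E B) (q : B) (y v w : E) :
    g.inChart q y v w = g.inChart q y w v :=
  g.symm _ _ _

/-- The trivialization of the tangent bundle is the differential of the chart, so this is the chain
rule. -/
theorem frameMap_mfderiv {i : M → B} {p x : M} (hi : MDifferentiableAt 𝓘(ℝ, F) 𝓘(ℝ, E) i x)
    (hx : i x ∈ (chartAt E (i p)).source) (u : TangentSpace 𝓘(ℝ, F) x) :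
    frameMap (i p) (i x) (mfderiv 𝓘(ℝ, F) 𝓘(ℝ, E) i x u) =
      mfderiv 𝓘(ℝ, F) 𝓘(ℝ, E) (fun x ↦ extChartAt 𝓘(ℝ, E) (i p) (i x)) x u := by
  have h2 : MDifferentiableAt 𝓘(ℝ, E) 𝓘(ℝ, E) (extChartAt 𝓘(ℝ, E) (i p)) (i x) :=
    mdifferentiableAt_extChartAt hx
  rw [frameMap, TangentBundle.continuousLinearMapAt_trivializationAt hx]
  exact (congrArg (fun L ↦ L u) (mfderiv_comp x h2 hi)).symm

theorem smoothAlongAt_iff {i : M → B} {V : ∀ x : M, TangentSpace 𝓘(ℝ, E) (i x)} {p : M} :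
    SmoothAlongAt (F := F) i V p ↔ ContMDiffAt 𝓘(ℝ, F) 𝓘(ℝ, E) ∞ i p ∧
      ContMDiffAt 𝓘(ℝ, F) 𝓘(ℝ, E) ∞ (inFrame i V p) p :=
  Bundle.contMDiffAt_totalSpace

theorem SmoothAlongAt.base {i : M → B} {V : ∀ x : M, TangentSpace 𝓘(ℝ, E) (i x)} {p : M}
    (h : SmoothAlongAt (F := F) i V p) : ContMDiffAt 𝓘(ℝ, F) 𝓘(ℝ, E) ∞ i p :=
  (smoothAlongAt_iff.1 h).1

theorem SmoothAlongAt.congr {i : M → B} {U V : ∀ x : M, TangentSpace 𝓘(ℝ, E) (i x)} {p : M}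
    (h : SmoothAlongAt (F := F) i V p) (e : ∀ᶠ x in 𝓝 p, U x = V x) :
    SmoothAlongAt (F := F) i U p :=
  ContMDiffAt.congr_of_eventuallyEq h (e.mono fun x hx ↦ by simp only [hx])

theorem SmoothAlongAt.of_frame {i : M → B} {V : ∀ x : M, TangentSpace 𝓘(ℝ, E) (i x)} {p : M}
    (hi : ContMDiffAt 𝓘(ℝ, F) 𝓘(ℝ, E) ∞ i p) {f : M → E} (hf : ContMDiffAt 𝓘(ℝ, F) 𝓘(ℝ, E) ∞ f p)
    (e : ∀ᶠ x in 𝓝 p, frameMap (i p) (i x) (V x) = f x) : SmoothAlongAt (F := F) i V p :=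
  smoothAlongAt_iff.2 ⟨hi, hf.congr_of_eventuallyEq
    ((e.and (eventually_mem_source E hi.continuousAt)).mono fun x hx ↦ by
      rw [inFrame_eq V hx.2, hx.1])⟩

theorem SmoothAlongAt.frame {i : M → B} {V : ∀ x : M, TangentSpace 𝓘(ℝ, E) (i x)} {p : M}
    (h : SmoothAlongAt (F := F) i V p) :
    ContMDiffAt 𝓘(ℝ, F) 𝓘(ℝ, E) ∞ (fun x ↦ frameMap (i p) (i x) (V x)) p :=
  (smoothAlongAt_iff.1 h).2.congr_of_eventuallyEq
    ((eventually_mem_source E h.base.continuousAt).mono fun _ hx ↦ (inFrame_eq V hx).symm)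

theorem SmoothAlongAt.sub {i : M → B} {U V : ∀ x : M, TangentSpace 𝓘(ℝ, E) (i x)} {p : M}
    (hU : SmoothAlongAt (F := F) i U p) (hV : SmoothAlongAt (F := F) i V p) :
    SmoothAlongAt (F := F) i (fun x ↦ U x - V x) p :=
  .of_frame hU.base (hU.frame.sub hV.frame) (.of_forall fun _ ↦ map_sub _ _ _)

theorem SmoothAlongAt.smul {i : M → B} {V : ∀ x : M, TangentSpace 𝓘(ℝ, E) (i x)} {p : M}
    {f : M → ℝ} (hf : ContMDiffAt 𝓘(ℝ, F) 𝓘(ℝ, ℝ) ∞ f p) (hV : SmoothAlongAt (F := F) i V p) :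
    SmoothAlongAt (F := F) i (fun x ↦ f x • V x) p :=
  .of_frame hV.base (hf.smul hV.frame) (.of_forall fun _ ↦ map_smul _ _ _)

theorem SmoothAlongAt.sum {ι : Type*} {s : Finset ι} {i : M → B}
    {V : ι → ∀ x : M, TangentSpace 𝓘(ℝ, E) (i x)} {p : M}
    (hi : ContMDiffAt 𝓘(ℝ, F) 𝓘(ℝ, E) ∞ i p) (hV : ∀ a ∈ s, SmoothAlongAt (F := F) i (V a) p) :
    SmoothAlongAt (F := F) i (fun x ↦ ∑ a ∈ s, V a x) p :=
  .of_frame hi (ContMDiffAt.sum fun a ha ↦ (hV a ha).frame) (.of_forall fun _ ↦ map_sum _ _ _)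

theorem SmoothAlongAt.inner (g : LorentzianMetric E B) {i : M → B}
    {U V : ∀ x : M, TangentSpace 𝓘(ℝ, E) (i x)} {p : M}
    (hU : SmoothAlongAt (F := F) i U p) (hV : SmoothAlongAt (F := F) i V p) :
    ContMDiffAt 𝓘(ℝ, F) 𝓘(ℝ, ℝ) ∞ (fun x ↦ g.inner (i x) (U x) (V x)) p := by
  have h := ContMDiffAt.clm_bundle_apply₂ (F₁ := E) (F₂ := E) (F₃ := ℝ)
    (E₃ := fun _ : B ↦ ℝ) (g.contMDiff.contMDiffAt.comp p hU.base) hU hV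
  rw [Bundle.contMDiffAt_totalSpace] at h
  exact h.2

theorem SmoothAlongAt.mfderiv {i : M → B} [IsManifold 𝓘(ℝ, F) ∞ M]
    (hi : ContMDiff 𝓘(ℝ, F) 𝓘(ℝ, E) ∞ i) {X : ∀ x : M, TangentSpace 𝓘(ℝ, F) x} {p : M}
    (hX : ContMDiffAt 𝓘(ℝ, F) 𝓘(ℝ, F).tangent ∞
      (fun x ↦ (⟨x, X x⟩ : TangentBundle 𝓘(ℝ, F) M)) p) :
    SmoothAlongAt (F := F) i (fun x ↦ mfderiv 𝓘(ℝ, F) 𝓘(ℝ, E) i x (X x)) p :=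
  ((hi.contMDiff_tangentMap (m := ∞) (by simp)).contMDiffAt).comp p hX

/-- An ambient tangent vector at `i p` extends to a field along `i` that is smooth at `p`. -/
theorem exists_smoothAlongAt {i : M → B} {p : M} (hi : ContMDiffAt 𝓘(ℝ, F) 𝓘(ℝ, E) ∞ i p)
    (v : TangentSpace 𝓘(ℝ, E) (i p)) :
    ∃ V : ∀ x : M, TangentSpace 𝓘(ℝ, E) (i x), SmoothAlongAt (F := F) i V p ∧ V p = v := by
  refine ⟨fun x ↦ (trivializationAt E (TangentSpace 𝓘(ℝ, E)) (i p)).symmL ℝ (i x)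
    (frameMap (i p) (i p) v), .of_frame hi (contMDiffAt_const (c := frameMap (i p) (i p) v)) ?_,
    symmL_frameMap (E := E) (mem_chart_source E (i p)) v⟩
  filter_upwards [eventually_mem_source E hi.continuousAt] with x hx
  exact Trivialization.continuousLinearMapAt_symmL (R := ℝ)
    (trivializationAt E (TangentSpace 𝓘(ℝ, E)) (i p)) (by simpa using hx) _

/-- The matrix entries are scalar products of smooth coordinate fields along the inverse chart. In
finite dimension, smoothness of a form-valued map can be tested on entries. -/
theorem contDiffAt_inChart [FiniteDimensional ℝ E] (g : LorentzianMetric E B) (q : B) :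
    ContDiffAt ℝ ∞ (g.inChart q) (extChartAt 𝓘(ℝ, E) q q) := by
  have hmem : (extChartAt 𝓘(ℝ, E) q).target ∈ 𝓝 (extChartAt 𝓘(ℝ, E) q q) :=
    extChartAt_target_mem_nhds q
  have key : ContDiffOn ℝ ∞ (g.inChart q) (extChartAt 𝓘(ℝ, E) q).target := by
    rw [contDiffOn_clm_apply]
    intro a
    rw [contDiffOn_clm_apply]
    intro b
    rw [← contMDiffOn_iff_contDiffOn]
    intro y hy
    have hs : ContMDiffAt 𝓘(ℝ, E) 𝓘(ℝ, E) ∞ (extChartAt 𝓘(ℝ, E) q).symm y :=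
      (contMDiffOn_extChartAt_symm (I := 𝓘(ℝ, E)) (n := ∞) q).contMDiffAt ((isOpen_extChartAt_target q).mem_nhds hy)
    have hsm : ∀ c : E, SmoothAlongAt (F := E) (extChartAt 𝓘(ℝ, E) q).symm (fun y ↦
        (trivializationAt E (TangentSpace 𝓘(ℝ, E)) q).symmL ℝ
          ((extChartAt 𝓘(ℝ, E) q).symm y) c) y := by
      intro c
      refine ((Trivialization.contMDiffAt_iff
        (e := trivializationAt E (TangentSpace 𝓘(ℝ, E)) q) (IB := 𝓘(ℝ, E))
        (f := fun y ↦ (⟨(extChartAt 𝓘(ℝ, E) q).symm y,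
          (trivializationAt E (TangentSpace 𝓘(ℝ, E)) q).symmL ℝ
            ((extChartAt 𝓘(ℝ, E) q).symm y) c⟩ : TangentBundle 𝓘(ℝ, E) B)) ?_).2 ⟨hs, ?_⟩)
      · rw [Trivialization.mem_source]
        simpa using (extChartAt 𝓘(ℝ, E) q).map_target hy
      · refine (contMDiffAt_const (c := c)).congr_of_eventuallyEq ?_
        filter_upwards [(isOpen_extChartAt_target q).mem_nhds hy] with z hz
        have hz' : (extChartAt 𝓘(ℝ, E) q).symm z ∈
            (trivializationAt E (TangentSpace 𝓘(ℝ, E)) q).baseSet := by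
          simpa using (extChartAt 𝓘(ℝ, E) q).map_target hz
        have := Trivialization.continuousLinearMapAt_symmL (R := ℝ)
          (trivializationAt E (TangentSpace 𝓘(ℝ, E)) q) hz' c
        rwa [Trivialization.continuousLinearMapAt_apply,
          Trivialization.coe_linearMapAt_of_mem _ hz'] at this
    exact ((hsm a).inner g (hsm b)).contMDiffWithinAt
  exact key.contDiffAt hmem

end LeviCivita

/-! ### Nondegeneracy, Christoffel symbols and metric compatibility -/

set_option synthInstance.maxHeartbeats 200000 in
theorem hasFDerivAt_bilin {E F : Type*} [NormedAddCommGroup E] [NormedSpace ℝ E]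
    [NormedAddCommGroup F] [NormedSpace ℝ F] {G : E → E →L[ℝ] E →L[ℝ] ℝ}
    {D : E →L[ℝ] E →L[ℝ] E →L[ℝ] ℝ} {y a b : F → E} {Y A B : F →L[ℝ] E} {x : F}
    (hG : HasFDerivAt G D (y x)) (hy : HasFDerivAt y Y x) (ha : HasFDerivAt a A x)
    (hb : HasFDerivAt b B x) :
    ∃ L : F →L[ℝ] ℝ, HasFDerivAt (fun z ↦ G (y z) (a z) (b z)) L x ∧
      ∀ u, L u = D (Y u) (a x) (b x) + G (y x) (A u) (b x) + G (y x) (a x) (B u) := by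
  refine ⟨_, ((hG.comp x hy).clm_apply ha).clm_apply hb, fun u ↦ ?_⟩
  simp
  ring

section LeviCivita

variable {E : Type*} [NormedAddCommGroup E] [NormedSpace ℝ E]
  {B : Type*} [TopologicalSpace B] [ChartedSpace E B] [IsManifold 𝓘(ℝ, E) ∞ B]
  {F : Type*} [NormedAddCommGroup F] [NormedSpace ℝ F]
  {M : Type*} [TopologicalSpace M] [ChartedSpace F M]

/-- Such a v is orthogonal to a timelike vector, so if nonzero it would satisfy ⟨v,v⟩ > 0, while
⟨v,v⟩ = 0. -/
theorem LorentzianMetric.eq_zero (g : LorentzianMetric E B) {x : B} {v : TangentSpace 𝓘(ℝ, E) x}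
    (h : ∀ w, g.inner x v w = 0) : v = 0 := by
  obtain ⟨t, -, ht⟩ := g.lorentzian x
  by_contra hv
  have := ht v hv (by rw [g.symm]; exact h t)
  rw [h v] at this
  exact lt_irrefl _ this

theorem LorentzianMetric.isInvertible [FiniteDimensional ℝ E] (g : LorentzianMetric E B) (x : B) :
    ContinuousLinearMap.IsInvertible (show E →L[ℝ] E →L[ℝ] ℝ from g.inner x) := by
  set G : E →L[ℝ] E →L[ℝ] ℝ := g.inner x
  have hinj : Function.Injective G := by
    rw [injective_iff_map_eq_zero]
    intro v hv
    exact g.eq_zero (x := x) (v := v) fun w ↦ congrArg (fun L ↦ L w) hv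
  have hfr : Module.finrank ℝ E = Module.finrank ℝ (E →L[ℝ] ℝ) := by
    rw [← (LinearMap.toContinuousLinearMap (𝕜 := ℝ) (E := E) (F' := ℝ)).finrank_eq,
      Module.finrank_linearMap_self]
  refine ⟨(LinearEquiv.ofInjectiveOfFinrankEq G.toLinearMap hinj hfr).toContinuousLinearEquiv, ?_⟩
  ext v w
  rfl

/-- The derivative at `q` of the metric in the preferred chart around `q`, as a trilinear form. -/
def LorentzianMetric.chartDeriv (g : LorentzianMetric E B) (q : B)
    (u v w : TangentSpace 𝓘(ℝ, E) q) : ℝ :=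
  fderiv ℝ (g.inChart q) (extChartAt 𝓘(ℝ, E) q q) u v w

/-- Invertibility of the metric makes `ContinuousLinearMap.inverse` a true inverse here. Christoffel
symbols are used below only through this formula with lowered index. -/
theorem inner_christoffel [FiniteDimensional ℝ E] (g : LorentzianMetric E B) (q : B)
    (u v w : TangentSpace 𝓘(ℝ, E) q) :
    g.inner q (g.christoffel q u v) w =
      1 / 2 * (g.chartDeriv q u v w + g.chartDeriv q v u w - g.chartDeriv q w u v) := by
  have h := (g.isInvertible q).self_apply_inverse ((1 / 2 : ℝ) •
    (fderiv ℝ (g.inChart q) (extChartAt 𝓘(ℝ, E) q q) u v +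
      fderiv ℝ (g.inChart q) (extChartAt 𝓘(ℝ, E) q q) v u -
      ((fderiv ℝ (g.inChart q) (extChartAt 𝓘(ℝ, E) q q)).flip u).flip v))
  exact congrArg (fun L : E →L[ℝ] ℝ ↦ L w) h

set_option synthInstance.maxHeartbeats 200000 in
theorem hasFDerivAt_inChart [FiniteDimensional ℝ E] (g : LorentzianMetric E B) (q : B) :
    HasFDerivAt (g.inChart q) (fderiv ℝ (g.inChart q) (extChartAt 𝓘(ℝ, E) q q))
      (extChartAt 𝓘(ℝ, E) q q) :=
  ((contDiffAt_inChart g q).differentiableAt (by simp)).hasFDerivAt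

theorem chartDeriv_symm [FiniteDimensional ℝ E] (g : LorentzianMetric E B) (q : B)
    (u v w : TangentSpace 𝓘(ℝ, E) q) : g.chartDeriv q u v w = g.chartDeriv q u w v := by
  have h (a b : E) : HasFDerivAt (fun y ↦ g.inChart q y a b)
      (((fderiv ℝ (g.inChart q) (extChartAt 𝓘(ℝ, E) q q)).flip a).flip b)
      (extChartAt 𝓘(ℝ, E) q q) := by
    have := ((hasFDerivAt_inChart g q).clm_apply (hasFDerivAt_const a _)).clm_apply
      (hasFDerivAt_const b _)
    convert! this using 1
    ext
    simp
  have h2 := h w v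
  simp_rw [inChart_symm g q _ w v] at h2
  exact congrArg (fun L : E →L[ℝ] ℝ ↦ L u) ((h v w).unique h2)

theorem exists_hasFDerivAt {V : Type*} [NormedAddCommGroup V] [NormedSpace ℝ V]
    {f : M → V} {p : M} (hf : MDifferentiableAt 𝓘(ℝ, F) 𝓘(ℝ, V) f p) :
    ∃ L : F →L[ℝ] V, HasFDerivAt (f ∘ (extChartAt 𝓘(ℝ, F) p).symm) L (extChartAt 𝓘(ℝ, F) p p) ∧
      ∀ u : TangentSpace 𝓘(ℝ, F) p, mfderiv 𝓘(ℝ, F) 𝓘(ℝ, V) f p u = L u := by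
  refine ⟨mfderiv 𝓘(ℝ, F) 𝓘(ℝ, V) f p, ?_, fun _ ↦ rfl⟩
  have := hf.hasMFDerivAt.2
  rw [modelWithCornersSelf_coe, range_id] at this
  have h : HasFDerivWithinAt (𝕜 := ℝ) (E := F) (F := V) (f ∘ (extChartAt 𝓘(ℝ, F) p).symm)
    (mfderiv 𝓘(ℝ, F) 𝓘(ℝ, V) f p) univ (extChartAt 𝓘(ℝ, F) p p) := this
  exact h.hasFDerivAt Filter.univ_mem

/-- The derivative of a function in the direction of a tangent vector. -/
def dirDeriv (f : M → ℝ) (p : M) (u : TangentSpace 𝓘(ℝ, F) p) : ℝ :=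
  mfderiv 𝓘(ℝ, F) 𝓘(ℝ, ℝ) f p u

/-- The differential of a field of ambient tangent vectors along a map, in the coordinate frame. -/
def dFrame (i : M → B) (V : ∀ x : M, TangentSpace 𝓘(ℝ, E) (i x)) (p : M)
    (u : TangentSpace 𝓘(ℝ, F) p) : TangentSpace 𝓘(ℝ, E) (i p) :=
  mfderiv 𝓘(ℝ, F) 𝓘(ℝ, E) (inFrame i V p) p u

theorem nabla_eq (g : LorentzianMetric E B) {i : M → B}
    (V : ∀ x : M, TangentSpace 𝓘(ℝ, E) (i x)) {p : M} (u : TangentSpace 𝓘(ℝ, F) p) :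
    g.nabla i V p u =
      dFrame i V p u + g.christoffel (i p) (mfderiv 𝓘(ℝ, F) 𝓘(ℝ, E) i p u) (V p) := rfl

theorem inFrame_self {i : M → B} (V : ∀ x : M, TangentSpace 𝓘(ℝ, E) (i x)) (p : M) :
    inFrame i V p p = V p := by
  rw [inFrame_eq V (mem_chart_source E (i p)), frameMap_self]

set_option synthInstance.maxHeartbeats 200000 in
/-- In coordinates, the differential of the scalar product of two fields along a map. -/
theorem mfderiv_inner [FiniteDimensional ℝ E] (g : LorentzianMetric E B) {i : M → B}
    {U V : ∀ x : M, TangentSpace 𝓘(ℝ, E) (i x)} {p : M}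
    (hU : SmoothAlongAt (F := F) i U p) (hV : SmoothAlongAt (F := F) i V p)
    (u : TangentSpace 𝓘(ℝ, F) p) :
    dirDeriv (fun x ↦ g.inner (i x) (U x) (V x)) p u =
      g.chartDeriv (i p) (mfderiv 𝓘(ℝ, F) 𝓘(ℝ, E) i p u) (U p) (V p) +
      g.inner (i p) (dFrame i U p u) (V p) + g.inner (i p) (U p) (dFrame i V p u) := by
  have hi := hU.base
  set y : M → E := fun x ↦ extChartAt 𝓘(ℝ, E) (i p) (i x) with hy
  have hyc : ContMDiffAt 𝓘(ℝ, F) 𝓘(ℝ, E) ∞ y p :=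
    (contMDiffAt_extChartAt (I := 𝓘(ℝ, E)) (n := ∞) (x := i p)).comp p hi
  have e : (fun x ↦ g.inner (i x) (U x) (V x)) =ᶠ[𝓝 p]
      fun x ↦ g.inChart (i p) (y x) (inFrame i U p x) (inFrame i V p x) := by
    filter_upwards [eventually_mem_source E hi.continuousAt] with x hx
    rw [inFrame_eq U hx, inFrame_eq V hx, inner_eq_inChart g hx]
  have hmd := (hU.inner g hV).mdifferentiableAt (by simp)
  obtain ⟨L, h0, hL⟩ := exists_hasFDerivAt (hmd.congr_of_eventuallyEq e.symm)
  obtain ⟨Y, hy1, hY⟩ := exists_hasFDerivAt (hyc.mdifferentiableAt (by simp))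
  obtain ⟨U', hU1, hU'⟩ := exists_hasFDerivAt
    ((smoothAlongAt_iff.1 hU).2.mdifferentiableAt (by simp))
  obtain ⟨V', hV1, hV'⟩ := exists_hasFDerivAt
    ((smoothAlongAt_iff.1 hV).2.mdifferentiableAt (by simp))
  have hsymm : (extChartAt 𝓘(ℝ, F) p).symm (extChartAt 𝓘(ℝ, F) p p) = p := extChartAt_to_inv p
  have hG : HasFDerivAt (g.inChart (i p)) (fderiv ℝ (g.inChart (i p)) (y p))
      ((y ∘ (extChartAt 𝓘(ℝ, F) p).symm) (extChartAt 𝓘(ℝ, F) p p)) := by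
    rw [Function.comp_apply, hsymm]
    exact hasFDerivAt_inChart g (i p)
  obtain ⟨L', h1, hL'⟩ := hasFDerivAt_bilin hG hy1 hU1 hV1
  have h2 : L u = L' u := congrArg (fun L : F →L[ℝ] ℝ ↦ L u) (h0.unique h1)
  have h3 : mfderiv 𝓘(ℝ, F) 𝓘(ℝ, E) y p u = mfderiv 𝓘(ℝ, F) 𝓘(ℝ, E) i p u := by
    rw [← frameMap_self (i p) (mfderiv 𝓘(ℝ, F) 𝓘(ℝ, E) i p u),
      frameMap_mfderiv (hi.mdifferentiableAt (by simp)) (mem_chart_source E (i p))]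
  rw [dirDeriv, e.mfderiv_eq]
  refine (hL u).trans (h2.trans ((hL' u).trans ?_))
  have h4 (v w : TangentSpace 𝓘(ℝ, E) (i p)) :
    g.inner (i p) v w = g.inChart (i p) (y p) v w := (inChart_self g (i p) v w).symm
  rw [LorentzianMetric.chartDeriv, ← h3, h4, h4, dFrame, dFrame, hY, hU', hV']
  simp only [Function.comp_apply, hsymm, inFrame_self]
  rfl

/-- The connection is compatible with the metric. -/
theorem mfderiv_inner_eq_nabla [FiniteDimensional ℝ E] (g : LorentzianMetric E B) {i : M → B}
    {U V : ∀ x : M, TangentSpace 𝓘(ℝ, E) (i x)} {p : M}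
    (hU : SmoothAlongAt (F := F) i U p) (hV : SmoothAlongAt (F := F) i V p)
    (u : TangentSpace 𝓘(ℝ, F) p) :
    dirDeriv (fun x ↦ g.inner (i x) (U x) (V x)) p u =
      g.inner (i p) (g.nabla i U p u) (V p) + g.inner (i p) (U p) (g.nabla i V p u) := by
  rw [mfderiv_inner g hU hV, g.symm (i p) (U p) (g.nabla i V p u), nabla_eq, nabla_eq,
    g.symm (i p) (U p) (dFrame i V p u)]
  simp only [map_add, add_apply, inner_christoffel]
  have h1 := chartDeriv_symm g (i p) (mfderiv 𝓘(ℝ, F) 𝓘(ℝ, E) i p u) (U p) (V p)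
  have h2 := chartDeriv_symm g (i p) (U p) (mfderiv 𝓘(ℝ, F) 𝓘(ℝ, E) i p u) (V p)
  have h3 := chartDeriv_symm g (i p) (V p) (mfderiv 𝓘(ℝ, F) 𝓘(ℝ, E) i p u) (U p)
  -- In the sum of the two Christoffel terms, the derivatives of the metric along U and V cancel and
  -- those along u add up.
  linarith

-- By nondegeneracy it suffices to pair with an arbitrary vector, and the lowered formula is visibly
-- linear. This makes ∇ compatible with Z^⊥ = Z - Z*.
set_option synthInstance.maxHeartbeats 200000 in
theorem christoffel_sub [FiniteDimensional ℝ E] (g : LorentzianMetric E B) (q : B)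
    (u v w : TangentSpace 𝓘(ℝ, E) q) :
    g.christoffel q u (v - w) = g.christoffel q u v - g.christoffel q u w := by
  refine sub_eq_zero.1 (g.eq_zero fun t ↦ ?_)
  have h2 : ∀ a b, g.chartDeriv q (v - w) a b = g.chartDeriv q v a b - g.chartDeriv q w a b :=
    fun a b ↦ congrArg (fun L : E →L[ℝ] E →L[ℝ] ℝ ↦ L a b)
      (ContinuousLinearMap.map_sub (fderiv ℝ (g.inChart q) (extChartAt 𝓘(ℝ, E) q q)) v w)
  have h4 : ∀ a b, g.chartDeriv q a b (v - w) = g.chartDeriv q a b v - g.chartDeriv q a b w :=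
    fun a b ↦ ContinuousLinearMap.map_sub
      (fderiv ℝ (g.inChart q) (extChartAt 𝓘(ℝ, E) q q) a b) v w
  simp only [map_sub, sub_apply, inner_christoffel, h2, h4, chartDeriv_symm g q u (v - w),
    chartDeriv_symm g q u v, chartDeriv_symm g q u w]
  ring

theorem nabla_sub [FiniteDimensional ℝ E] (g : LorentzianMetric E B) {i : M → B}
    {U V : ∀ x : M, TangentSpace 𝓘(ℝ, E) (i x)} {p : M}
    (hU : SmoothAlongAt (F := F) i U p) (hV : SmoothAlongAt (F := F) i V p)
    (u : TangentSpace 𝓘(ℝ, F) p) :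
    g.nabla i (fun x ↦ U x - V x) p u = g.nabla i U p u - g.nabla i V p u := by
  have e : inFrame i (fun x ↦ U x - V x) p =ᶠ[𝓝 p] inFrame i U p - inFrame i V p := by
    filter_upwards [eventually_mem_source E hU.base.continuousAt] with x hx
    rw [Pi.sub_apply, inFrame_eq _ hx, inFrame_eq _ hx, inFrame_eq _ hx, map_sub]
  have hd : dFrame i (fun x ↦ U x - V x) p u = dFrame i U p u - dFrame i V p u := by
    rw [dFrame, e.mfderiv_eq]
    exact congrArg (fun L : F →L[ℝ] E ↦ L u)
      (mfderiv_sub (z := p) (f := inFrame i U p) (g := inFrame i V p)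
        ((smoothAlongAt_iff.1 hU).2.mdifferentiableAt (by simp))
        ((smoothAlongAt_iff.1 hV).2.mdifferentiableAt (by simp)))
  rw [nabla_eq, nabla_eq, nabla_eq, hd, christoffel_sub]
  abel

end LeviCivita

/-! ### Symmetry of the shape operator of an integrable distribution -/

section Integrable

variable {E : Type*} [NormedAddCommGroup E] [NormedSpace ℝ E]
  {B : Type*} [TopologicalSpace B] [ChartedSpace E B] [IsManifold 𝓘(ℝ, E) ∞ B]
  {F : Type*} [NormedAddCommGroup F] [NormedSpace ℝ F]
  {M : Type*} [TopologicalSpace M] [ChartedSpace F M]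
  {K : Type*} [NormedAddCommGroup K] [NormedSpace ℝ K]

/-- The derivative at `w` of a map from a vector space, in the direction `b`. -/
def push (h : K → B) (w b : K) : TangentSpace 𝓘(ℝ, E) (h w) :=
  mfderiv 𝓘(ℝ, K) 𝓘(ℝ, E) h w b

/-- The second derivative at `w` of a map from a vector space, in the preferred chart. -/
def secondDeriv (h : K → B) (w a b : K) : TangentSpace 𝓘(ℝ, E) (h w) :=
  fderiv ℝ (fderiv ℝ fun z ↦ extChartAt 𝓘(ℝ, E) (h w) (h z)) w a b

theorem contDiffAt_chart {h : K → B} {w : K} (hh : ContMDiffAt 𝓘(ℝ, K) 𝓘(ℝ, E) ∞ h w) :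
    ContDiffAt ℝ ∞ (fun z ↦ extChartAt 𝓘(ℝ, E) (h w) (h z)) w :=
  contMDiffAt_iff_contDiffAt.1
    ((contMDiffAt_extChartAt (I := 𝓘(ℝ, E)) (n := ∞) (x := h w)).comp w hh)

/-- Schwarz's theorem in a chart; together with the symmetric Christoffel formula it plays the role
of torsion-freeness. -/
theorem secondDeriv_symm {h : K → B} {w : K} (hh : ContMDiffAt 𝓘(ℝ, K) 𝓘(ℝ, E) ∞ h w) (a b : K) :
    (secondDeriv h w a b : TangentSpace 𝓘(ℝ, E) (h w)) = secondDeriv h w b a :=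
  (contDiffAt_chart hh).isSymmSndFDerivAt
    (by simpa using (by exact_mod_cast le_top : ((2 : ℕ∞) : WithTop ℕ∞) ≤ ∞)) a b

theorem frameMap_push {h : K → B} {w₀ w : K} (hh : ContMDiffAt 𝓘(ℝ, K) 𝓘(ℝ, E) ∞ h w)
    (hw : h w ∈ (chartAt E (h w₀)).source) (b : K) :
    frameMap (h w₀) (h w) (push h w b) =
      fderiv ℝ (fun z ↦ extChartAt 𝓘(ℝ, E) (h w₀) (h z)) w b := by
  rw [← mfderiv_eq_fderiv]
  exact frameMap_mfderiv (hh.mdifferentiableAt (by simp)) hw b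

theorem smoothAlongAt_push {h : K → B} {w₀ : K}
    (hh : ∀ᶠ w in 𝓝 w₀, ContMDiffAt 𝓘(ℝ, K) 𝓘(ℝ, E) ∞ h w) (b : K) :
    SmoothAlongAt (F := K) (E := E) h (fun w ↦ push h w b) w₀ := by
  refine .of_frame hh.self_of_nhds ((((contDiffAt_chart hh.self_of_nhds).fderiv_right
    (m := ∞) (by simp)).clm_apply (contDiffAt_const (c := b))).contMDiffAt) ?_
  filter_upwards [hh, eventually_mem_source E hh.self_of_nhds.continuousAt] with w hw hs
  exact frameMap_push hw hs b

/-- The components of the pushforward of a constant field are first partial derivatives near w₀, so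
differentiating once more gives the second derivative. -/
theorem dFrame_push {h : K → B} {w₀ : K}
    (hh : ∀ᶠ w in 𝓝 w₀, ContMDiffAt 𝓘(ℝ, K) 𝓘(ℝ, E) ∞ h w) (a b : K) :
    dFrame (E := E) h (fun w ↦ push h w b) w₀ (show TangentSpace 𝓘(ℝ, K) w₀ from a) =
      secondDeriv h w₀ a b := by
  have e : inFrame (E := E) h (fun w ↦ push h w b) w₀ =ᶠ[𝓝 w₀]
      fun w ↦ fderiv ℝ (fun z ↦ extChartAt 𝓘(ℝ, E) (h w₀) (h z)) w b := by
    filter_upwards [hh, eventually_mem_source E hh.self_of_nhds.continuousAt] with w hw hs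
    rw [inFrame_eq _ hs, frameMap_push hw hs b]
  have hd := (contDiffAt_chart hh.self_of_nhds).fderiv_right (m := ∞) (by simp)
  have h1 : fderiv ℝ (fun w ↦ fderiv ℝ (fun z ↦ extChartAt 𝓘(ℝ, E) (h w₀) (h z)) w b) w₀ a =
      fderiv ℝ (fderiv ℝ fun z ↦ extChartAt 𝓘(ℝ, E) (h w₀) (h z)) w₀ a b := by
    rw [fderiv_clm_apply (hd.differentiableAt (by simp)) (differentiableAt_const b)]
    simp
  rw [← mfderiv_eq_fderiv] at h1
  unfold dFrame
  rw [e.mfderiv_eq]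
  exact h1

/-- The shape operator of an integrable distribution is symmetric. -/
theorem inner_nabla_symm_of_isIntegrable [FiniteDimensional ℝ E] [IsManifold 𝓘(ℝ, F) ∞ M]
    (g : LorentzianMetric E B) {i : M → B} (hi : ContMDiff 𝓘(ℝ, F) 𝓘(ℝ, E) ∞ i)
    {S : ∀ p : M, Submodule ℝ (TangentSpace 𝓘(ℝ, F) p)} (hS : IsIntegrable S)
    {V : ∀ x : M, TangentSpace 𝓘(ℝ, E) (i x)} {p : M} (hV : SmoothAlongAt (F := F) i V p)
    (hVS : ∀ x, ∀ X ∈ S x, g.inner (i x) (V x) (mfderiv 𝓘(ℝ, F) 𝓘(ℝ, E) i x X) = 0)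
    {X Y : TangentSpace 𝓘(ℝ, F) p} (hX : X ∈ S p) (hY : Y ∈ S p) :
    g.inner (i p) (g.nabla i V p X) (mfderiv 𝓘(ℝ, F) 𝓘(ℝ, E) i p Y) =
      g.inner (i p) (g.nabla i V p Y) (mfderiv 𝓘(ℝ, F) 𝓘(ℝ, E) i p X) := by
  obtain ⟨k, W, j, hW, hj, ⟨w₀, hw₀, rfl⟩, hjS⟩ := hS p
  have hjat : ∀ w ∈ W, ContMDiffAt 𝓘(ℝ, EuclideanSpace ℝ (Fin k)) 𝓘(ℝ, F) ∞ j w :=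
    fun w hw ↦ hj.contMDiffAt (hW.mem_nhds hw)
  have hjd : ∀ w ∈ W, MDifferentiableAt 𝓘(ℝ, EuclideanSpace ℝ (Fin k)) 𝓘(ℝ, F) j w :=
    fun w hw ↦ (hjat w hw).mdifferentiableAt (by simp)
  have hid := hi.mdifferentiable (by simp)
  set h : EuclideanSpace ℝ (Fin k) → B := fun w ↦ i (j w) with hh
  have hhat : ∀ᶠ w in 𝓝 w₀, ContMDiffAt 𝓘(ℝ, EuclideanSpace ℝ (Fin k)) 𝓘(ℝ, E) ∞ h w := by
    filter_upwards [hW.mem_nhds hw₀] with w hw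
    exact hi.contMDiffAt.comp w (hjat w hw)
  have hchain : ∀ w ∈ W, ∀ a, (push h w a : TangentSpace 𝓘(ℝ, E) (h w)) =
      mfderiv 𝓘(ℝ, F) 𝓘(ℝ, E) i (j w) (push (E := F) j w a) := fun w hw a ↦
    congrArg (fun L ↦ L a) (mfderiv_comp w (hid (j w)) (hjd w hw))
  have hV' : SmoothAlongAt (F := EuclideanSpace ℝ (Fin k)) h (fun w ↦ V (j w)) w₀ :=
    ContMDiffAt.comp w₀ hV (hjat w₀ hw₀)
  have hdV : ∀ a : EuclideanSpace ℝ (Fin k), dFrame h (fun w ↦ V (j w)) w₀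
      (show TangentSpace 𝓘(ℝ, EuclideanSpace ℝ (Fin k)) w₀ from a) =
      dFrame i V (j w₀) (push (E := F) j w₀ a) := fun a ↦
    congrArg (fun L ↦ L a) (mfderiv_comp (g := inFrame i V (j w₀)) w₀
      ((smoothAlongAt_iff.1 hV).2.mdifferentiableAt (by simp)) (hjd w₀ hw₀))
  have hmem : ∀ w ∈ W, ∀ a, push (E := F) j w a ∈ S (j w) := by
    intro w hw a
    rw [← (hjS w hw).2]
    exact ⟨a, rfl⟩
  -- Differentiate ⟨V, h_* b⟩ = 0 in the direction a: the pushforwards of constant fields are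
  -- tangent to the integral manifold, to which V is orthogonal.
  have key : ∀ a b : EuclideanSpace ℝ (Fin k),
      g.chartDeriv (i (j w₀)) (mfderiv 𝓘(ℝ, F) 𝓘(ℝ, E) i (j w₀) (push (E := F) j w₀ a)) (V (j w₀))
        (mfderiv 𝓘(ℝ, F) 𝓘(ℝ, E) i (j w₀) (push (E := F) j w₀ b)) +
      g.inner (i (j w₀)) (dFrame i V (j w₀) (push (E := F) j w₀ a))
        (mfderiv 𝓘(ℝ, F) 𝓘(ℝ, E) i (j w₀) (push (E := F) j w₀ b)) +
      g.inner (i (j w₀)) (V (j w₀)) (secondDeriv h w₀ a b) = 0 := by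
    intro a b
    have h1 := mfderiv_inner g hV' (smoothAlongAt_push hhat b)
      (show TangentSpace 𝓘(ℝ, EuclideanSpace ℝ (Fin k)) w₀ from a)
    rw [dFrame_push hhat, hdV] at h1
    have h2 : mfderiv 𝓘(ℝ, EuclideanSpace ℝ (Fin k)) 𝓘(ℝ, E) h w₀
        (show TangentSpace 𝓘(ℝ, EuclideanSpace ℝ (Fin k)) w₀ from a) =
          mfderiv 𝓘(ℝ, F) 𝓘(ℝ, E) i (j w₀) (push (E := F) j w₀ a) := hchain w₀ hw₀ a
    rw [h2, hchain w₀ hw₀ b] at h1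
    refine h1.symm.trans ?_
    have e : (fun w ↦ g.inner (h w) (V (j w)) (push h w b)) =ᶠ[𝓝 w₀] fun _ ↦ (0 : ℝ) := by
      filter_upwards [hW.mem_nhds hw₀] with w hw
      rw [hchain w hw]
      exact hVS _ _ (hmem w hw b)
    rw [dirDeriv, e.mfderiv_eq, mfderiv_const]
    rfl
  rw [← (hjS w₀ hw₀).2] at hX hY
  obtain ⟨(a : EuclideanSpace ℝ (Fin k)), rfl⟩ := hX
  obtain ⟨(b : EuclideanSpace ℝ (Fin k)), rfl⟩ := hY
  have h1 := key a b
  have h2 := key b a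
  rw [secondDeriv_symm hhat.self_of_nhds b a] at h2
  change g.inner (i (j w₀)) (g.nabla i V (j w₀) (push (E := F) j w₀ a))
      (mfderiv 𝓘(ℝ, F) 𝓘(ℝ, E) i (j w₀) (push (E := F) j w₀ b)) =
    g.inner (i (j w₀)) (g.nabla i V (j w₀) (push (E := F) j w₀ b))
      (mfderiv 𝓘(ℝ, F) 𝓘(ℝ, E) i (j w₀) (push (E := F) j w₀ a))
  rw [nabla_eq, nabla_eq]
  simp only [map_add, add_apply]
  rw [inner_christoffel, inner_christoffel]
  have s := chartDeriv_symm g (i (j w₀))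
  have s1 := s (mfderiv 𝓘(ℝ, F) 𝓘(ℝ, E) i (j w₀) (push (E := F) j w₀ a))
    (mfderiv 𝓘(ℝ, F) 𝓘(ℝ, E) i (j w₀) (push (E := F) j w₀ b)) (V (j w₀))
  have s2 := s (mfderiv 𝓘(ℝ, F) 𝓘(ℝ, E) i (j w₀) (push (E := F) j w₀ b))
    (mfderiv 𝓘(ℝ, F) 𝓘(ℝ, E) i (j w₀) (push (E := F) j w₀ a)) (V (j w₀))
  have s3 := s (V (j w₀)) (mfderiv 𝓘(ℝ, F) 𝓘(ℝ, E) i (j w₀) (push (E := F) j w₀ a))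
    (mfderiv 𝓘(ℝ, F) 𝓘(ℝ, E) i (j w₀) (push (E := F) j w₀ b))
  -- After eliminating the `dFrame` terms, both sides equal -⟨V, h''(a,b) + Γ(X,Y)⟩, which is
  -- symmetric.
  linarith

end Integrable

/-! ### Orthogonal complements for bilinear forms -/

section LinearAlgebra

variable {V W : Type*} [AddCommGroup V] [Module ℝ V] [FiniteDimensional ℝ V]
  [AddCommGroup W] [Module ℝ W] [FiniteDimensional ℝ W]

/-- The orthogonal complement of a hyperplane is spanned by any of its nonzero vectors. -/
theorem exists_eq_smul_of_perp_hyperplane {G : V →ₗ[ℝ] V →ₗ[ℝ] ℝ}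
    (hG : ∀ v, (∀ w, G v w = 0) → v = 0) {d : W →ₗ[ℝ] V} (hd : Function.Injective d)
    (hr : Module.finrank ℝ V = Module.finrank ℝ W + 1) {n v : V} (hn : n ≠ 0)
    (hnd : ∀ w, G n (d w) = 0) (hvd : ∀ w, G v (d w) = 0) : ∃ c : ℝ, v = c • n := by
  have hGi : Function.Injective G := by
    rw [injective_iff_map_eq_zero]
    intro u hu
    exact hG u fun w ↦ by rw [hu]; rfl
  have hGs : Function.Surjective G :=
    (LinearMap.injective_iff_surjective_of_finrank_eq_finrank
      (Subspace.dual_finrank_eq (K := ℝ) (V := V)).symm).1 hGi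
  set Φ : V →ₗ[ℝ] Module.Dual ℝ W := d.dualMap.comp G with hΦ
  have hs : Function.Surjective Φ := by
    rw [hΦ, LinearMap.coe_comp]
    exact (LinearMap.dualMap_surjective_of_injective hd).comp hGs
  have h1 := Φ.finrank_range_add_finrank_ker
  rw [LinearMap.range_eq_top.2 hs, finrank_top, Subspace.dual_finrank_eq, hr] at h1
  have h2 : Module.finrank ℝ (LinearMap.ker Φ) = 1 := by omega
  have hn' : n ∈ LinearMap.ker Φ := LinearMap.ext hnd
  have hv' : v ∈ LinearMap.ker Φ := LinearMap.ext hvd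
  obtain ⟨c, hc⟩ := (finrank_eq_one_iff_of_nonzero' (⟨n, hn'⟩ : LinearMap.ker Φ)
    (fun h ↦ hn (congrArg Subtype.val h))).1 h2 ⟨v, hv'⟩
  exact ⟨c, (congrArg Subtype.val hc).symm⟩

/-- On a subspace where a bilinear form is nondegenerate, every functional is represented. -/
theorem exists_mem_forall_eq {G : V →ₗ[ℝ] V →ₗ[ℝ] ℝ} {S : Submodule ℝ V}
    (hG : ∀ v ∈ S, (∀ w ∈ S, G v w = 0) → v = 0) (f : V →ₗ[ℝ] ℝ) :
    ∃ u ∈ S, ∀ w ∈ S, G u w = f w := by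
  set Φ : S →ₗ[ℝ] Module.Dual ℝ S := S.subtype.dualMap.comp (G.comp S.subtype) with hΦ
  have hi : Function.Injective Φ := by
    rw [injective_iff_map_eq_zero]
    intro u hu
    exact Subtype.ext (hG u u.2 fun w hw ↦ congrArg (fun L ↦ L (⟨w, hw⟩ : S)) hu)
  obtain ⟨u, hu⟩ := (LinearMap.injective_iff_surjective_of_finrank_eq_finrank
      (Subspace.dual_finrank_eq (K := ℝ) (V := S)).symm).1 hi (f.comp S.subtype)
  exact ⟨u, u.2, fun w hw ↦ congrArg (fun L ↦ L (⟨w, hw⟩ : S)) hu⟩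

/-- On a subspace where a symmetric bilinear form is nondegenerate, a vector orthogonal to
everything orthogonal to `v` is a multiple of `v`. -/
theorem exists_eq_smul_of_perp {G : V →ₗ[ℝ] V →ₗ[ℝ] ℝ} {S : Submodule ℝ V}
    (hG : ∀ v ∈ S, (∀ w ∈ S, G v w = 0) → v = 0) {u v : V} (hu : u ∈ S) (hv : v ∈ S)
    (h : ∀ w ∈ S, G v w = 0 → G u w = 0) : ∃ c : ℝ, u = c • v := by
  by_cases hv0 : v = 0
  · exact ⟨0, by rw [zero_smul]; exact hG u hu fun w hw ↦ h w hw (by rw [hv0]; simp)⟩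
  obtain ⟨t, ht, htv⟩ : ∃ t ∈ S, G v t ≠ 0 := by
    by_contra! hcon
    exact hv0 (hG v hv hcon)
  -- The vector v itself may be isotropic, so an auxiliary t with ⟨v,t⟩ ≠ 0 is used: each w is
  -- corrected by a multiple of t to become orthogonal to v.
  refine ⟨G u t / G v t, sub_eq_zero.1 (hG _ (S.sub_mem hu (S.smul_mem _ hv)) fun w hw ↦ ?_)⟩
  have h1 := h (w - (G v w / G v t) • t) (S.sub_mem hw (S.smul_mem _ ht)) (by
    simp only [map_sub, map_smul, smul_eq_mul]
    field_simp
    ring)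
  simp only [map_sub, map_smul, smul_eq_mul, LinearMap.sub_apply, LinearMap.smul_apply] at h1 ⊢
  field_simp at h1 ⊢
  linarith

end LinearAlgebra

/-! ### The screen projection and its smoothness -/

section Null

variable {E : Type*} [NormedAddCommGroup E] [NormedSpace ℝ E] [FiniteDimensional ℝ E]
  {B : Type*} [TopologicalSpace B] [ChartedSpace E B] [IsManifold 𝓘(ℝ, E) ∞ B]
  {F : Type*} [NormedAddCommGroup F] [NormedSpace ℝ F] [FiniteDimensional ℝ F]
  {M : Type*} [TopologicalSpace M] [ChartedSpace F M] [IsManifold 𝓘(ℝ, F) ∞ M]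
  {g : LorentzianMetric E B} {i : M → B}
  {S : ∀ p : M, Submodule ℝ (TangentSpace 𝓘(ℝ, F) p)}

instance finiteDimensional_tangentSpace (p : M) : FiniteDimensional ℝ (TangentSpace 𝓘(ℝ, F) p) :=
  inferInstanceAs (FiniteDimensional ℝ F)

/-- The metric as a bilinear map. -/
def LorentzianMetric.bilin (g : LorentzianMetric E B) (x : B) :
    TangentSpace 𝓘(ℝ, E) x →ₗ[ℝ] TangentSpace 𝓘(ℝ, E) x →ₗ[ℝ] ℝ :=
  LinearMap.mk₂ ℝ (fun v w ↦ g.inner x v w) (by simp) (by simp) (by simp) (by simp)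

/-- The induced metric as a bilinear map. -/
def inducedBilin (g : LorentzianMetric E B) (i : M → B) (p : M) :
    TangentSpace 𝓘(ℝ, F) p →ₗ[ℝ] TangentSpace 𝓘(ℝ, F) p →ₗ[ℝ] ℝ :=
  LinearMap.mk₂ ℝ (induced g i p) (by simp [induced]) (by simp [induced]) (by simp [induced])
    (by simp [induced])

/-- A vector of S orthogonal to S is orthogonal to S ⊕ rad = TM, so it lies in S ∩ rad = 0. Thus the
metric is nondegenerate on S. -/
theorem IsNullHypersurface.eq_zero (hM : IsNullHypersurface g i S) {p : M}
    {u : TangentSpace 𝓘(ℝ, F) p} (hu : u ∈ S p) (h : ∀ w ∈ S p, induced g i p u w = 0) :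
    u = 0 := by
  have hr : u ∈ radical g i p := by
    intro w
    have hw : w ∈ S p ⊔ radical g i p := by
      rw [(hM.screen_compl p).sup_eq_top]
      trivial
    obtain ⟨s, hs, r, hr, rfl⟩ := Submodule.mem_sup.1 hw
    have h1 : induced g i p u r = 0 := (g.symm _ _ _).trans (hr u)
    have h2 := h s hs
    simp only [induced, map_add] at h1 h2 ⊢
    rw [h1, h2, add_zero]
  exact (Submodule.disjoint_def.1 (hM.screen_compl p).disjoint) u hu hr

/-- Nondegeneracy on S represents the functional ⟨v, ·⟩ by a vector of S, so the default value 0 in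
`screenPart` never occurs. -/
theorem IsNullHypersurface.screenPart_spec (hM : IsNullHypersurface g i S) (p : M)
    (v : TangentSpace 𝓘(ℝ, E) (i p)) :
    screenPart g i S p v ∈ S p ∧ ∀ w ∈ S p,
      g.inner (i p) (v - mfderiv 𝓘(ℝ, F) 𝓘(ℝ, E) i p (screenPart g i S p v))
        (mfderiv 𝓘(ℝ, F) 𝓘(ℝ, E) i p w) = 0 := by
  have h : ∃ u ∈ S p, ∀ w ∈ S p, g.inner (i p) (v - mfderiv 𝓘(ℝ, F) 𝓘(ℝ, E) i p u)
      (mfderiv 𝓘(ℝ, F) 𝓘(ℝ, E) i p w) = 0 := by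
    obtain ⟨u, hu, h⟩ := exists_mem_forall_eq (G := inducedBilin g i p) (S := S p)
      (fun v hv h ↦ hM.eq_zero hv h)
      ((g.bilin (i p) v).comp (mfderiv 𝓘(ℝ, F) 𝓘(ℝ, E) i p).toLinearMap)
    refine ⟨u, hu, fun w hw ↦ ?_⟩
    rw [map_sub, sub_apply, sub_eq_zero]
    exact (h w hw).symm
  rw [screenPart, dif_pos h]
  exact h.choose_spec

theorem IsNullHypersurface.screenPart_eq (hM : IsNullHypersurface g i S) {p : M}
    {v : TangentSpace 𝓘(ℝ, E) (i p)} {u : TangentSpace 𝓘(ℝ, F) p} (hu : u ∈ S p)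
    (h : ∀ w ∈ S p, g.inner (i p) (v - mfderiv 𝓘(ℝ, F) 𝓘(ℝ, E) i p u)
      (mfderiv 𝓘(ℝ, F) 𝓘(ℝ, E) i p w) = 0) : screenPart g i S p v = u := by
  obtain ⟨h1, h2⟩ := hM.screenPart_spec p v
  refine sub_eq_zero.1 (hM.eq_zero ((S p).sub_mem h1 hu) fun w hw ↦ ?_)
  have h3 := h2 w hw
  have h4 := h w hw
  simp only [induced, map_sub, sub_apply] at h3 h4 ⊢
  linarith

/-- The inner product with a vector of the screen space sees the screen component only. -/
theorem IsNullHypersurface.induced_screenPart (hM : IsNullHypersurface g i S) {p : M}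
    (v : TangentSpace 𝓘(ℝ, E) (i p)) {w : TangentSpace 𝓘(ℝ, F) p} (hw : w ∈ S p) :
    induced g i p (screenPart g i S p v) w =
      g.inner (i p) v (mfderiv 𝓘(ℝ, F) 𝓘(ℝ, E) i p w) := by
  have h := (hM.screenPart_spec p v).2 w hw
  rw [map_sub, sub_apply, sub_eq_zero] at h
  exact h.symm

theorem contMDiffAt_det {k : ℕ} {H : M → Matrix (Fin k) (Fin k) ℝ} {p : M}
    (h : ∀ a b, ContMDiffAt 𝓘(ℝ, F) 𝓘(ℝ, ℝ) ∞ (fun x ↦ H x a b) p) :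
    ContMDiffAt 𝓘(ℝ, F) 𝓘(ℝ, ℝ) ∞ (fun x ↦ (H x).det) p := by
  simp only [Matrix.det_apply']
  exact ContMDiffAt.sum fun σ _ ↦ contMDiffAt_const.mul (contMDiffAt_finsetProd fun a _ ↦ h _ _)

/-- In a local frame of S, the coefficients of the projection solve a linear system whose matrix is
the Gram matrix; Cramer's rule makes them visibly smooth. -/
theorem IsNullHypersurface.smoothAlongAt_screenPart (hM : IsNullHypersurface g i S) {p : M}
    {V : ∀ x : M, TangentSpace 𝓘(ℝ, E) (i x)} (hV : SmoothAlongAt (F := F) i V p) :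
    SmoothAlongAt (F := F) i
      (fun x ↦ mfderiv 𝓘(ℝ, F) 𝓘(ℝ, E) i x (screenPart g i S x (V x))) p := by
  obtain ⟨U, hU, hp, k, X, hX, hXS⟩ := hM.screen_smooth p
  set Y : Fin k → ∀ x : M, TangentSpace 𝓘(ℝ, E) (i x) :=
    fun a x ↦ mfderiv 𝓘(ℝ, F) 𝓘(ℝ, E) i x (X a x) with hY
  have hYs : ∀ a, SmoothAlongAt (F := F) i (Y a) p := fun a ↦
    SmoothAlongAt.mfderiv hM.smooth ((hX a).contMDiffAt (hU.mem_nhds hp))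
  set H : M → Matrix (Fin k) (Fin k) ℝ := fun x ↦ .of fun a b ↦ g.inner (i x) (Y a x) (Y b x)
    with hH
  set h : M → Fin k → ℝ := fun x a ↦ g.inner (i x) (V x) (Y a x) with hh
  have hHs : ∀ a b, ContMDiffAt 𝓘(ℝ, F) 𝓘(ℝ, ℝ) ∞ (fun x ↦ H x a b) p :=
    fun a b ↦ (hYs a).inner g (hYs b)
  have hhs : ∀ a, ContMDiffAt 𝓘(ℝ, F) 𝓘(ℝ, ℝ) ∞ (fun x ↦ h x a) p :=
    fun a ↦ hV.inner g (hYs a)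
  have hXmem : ∀ x ∈ U, ∀ a, X a x ∈ S x := fun x hx a ↦ by
    rw [← (hXS x hx).2]
    exact Submodule.subset_span ⟨a, rfl⟩
  have hspan : ∀ x ∈ U, ∀ v : TangentSpace 𝓘(ℝ, E) (i x), (∀ a, g.inner (i x) v (Y a x) = 0) →
      ∀ w ∈ S x, g.inner (i x) v (mfderiv 𝓘(ℝ, F) 𝓘(ℝ, E) i x w) = 0 := by
    intro x hx v hv w hw
    rw [← (hXS x hx).2] at hw
    induction hw using Submodule.span_induction with
    | mem w hw => obtain ⟨a, rfl⟩ := hw; exact hv a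
    | zero => simp
    | add u w _ _ h1 h2 => rw [map_add, map_add, h1, h2, add_zero]
    | smul c w _ h1 => rw [map_smul, map_smul, h1, smul_zero]
  have hmul : ∀ x (c : Fin k → ℝ) (b : Fin k),
      g.inner (i x) (mfderiv 𝓘(ℝ, F) 𝓘(ℝ, E) i x (∑ a, c a • X a x)) (Y b x) =
        (H x).mulVec c b := by
    intro x c b
    rw [g.symm, map_sum, map_sum]
    simp only [map_smul, Matrix.mulVec, dotProduct, smul_eq_mul, hH, hY, Matrix.of_apply]
    exact Finset.sum_congr rfl fun a _ ↦ mul_comm _ _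
  -- A kernel vector of the Gram matrix would give a vector of S orthogonal to S, hence zero,
  -- against independence of the frame.
  have hdet : ∀ x ∈ U, (H x).det ≠ 0 := by
    intro x hx h0
    obtain ⟨c, hc, hc0⟩ := Matrix.exists_mulVec_eq_zero_iff.2 h0
    refine hc (funext fun a ↦ ?_)
    have hz : ∑ a, c a • X a x = 0 := by
      refine hM.eq_zero ((S x).sum_mem fun a _ ↦ (S x).smul_mem _ (hXmem x hx a)) ?_
      refine hspan x hx _ fun b ↦ ?_
      rw [hmul, hc0, Pi.zero_apply]
    exact Fintype.linearIndependent_iff.1 (hXS x hx).1 c hz a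
  set c : Fin k → M → ℝ := fun a x ↦ (H x).det⁻¹ * ((H x).updateCol a (h x)).det with hc
  have hcs : ∀ a, ContMDiffAt 𝓘(ℝ, F) 𝓘(ℝ, ℝ) ∞ (c a) p := by
    intro a
    have hinv : ContMDiffAt 𝓘(ℝ, F) 𝓘(ℝ, ℝ) ∞ (fun x ↦ (H x).det⁻¹) p :=
      (contMDiffAt_det hHs).inv₀ (hdet p hp)
    refine hinv.mul (contMDiffAt_det fun b b' ↦ ?_)
    simp only [Matrix.updateCol_apply]
    split_ifs
    · exact hhs b
    · exact hHs b b'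
  refine (SmoothAlongAt.sum (s := Finset.univ) hV.base
    fun a _ ↦ (hYs a).smul (hcs a)).congr ?_
  filter_upwards [hU.mem_nhds hp] with x hx
  have hs : screenPart g i S x (V x) = ∑ a, c a x • X a x := by
    refine hM.screenPart_eq ((S x).sum_mem fun a _ ↦ (S x).smul_mem _ (hXmem x hx a)) ?_
    refine hspan x hx _ fun b ↦ ?_
    rw [map_sub, sub_apply, hmul]
    have h1 : (fun a ↦ c a x) = (H x).det⁻¹ • (H x).cramer (h x) := by
      ext a
      simp [hc, Matrix.cramer_apply]
    rw [h1, Matrix.mulVec_smul, Matrix.mulVec_cramer, inv_smul_smul₀ (hdet x hx)]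
    exact sub_self _
  rw [hs, map_sum]
  simp only [map_smul, hY]

end Null

/-! ### Existence of null frames and the decomposition of Z -/

section Null

variable {E : Type*} [NormedAddCommGroup E] [NormedSpace ℝ E] [FiniteDimensional ℝ E]
  {B : Type*} [TopologicalSpace B] [ChartedSpace E B] [IsManifold 𝓘(ℝ, E) ∞ B]
  {F : Type*} [NormedAddCommGroup F] [NormedSpace ℝ F] [FiniteDimensional ℝ F]
  {M : Type*} [TopologicalSpace M] [ChartedSpace F M] [IsManifold 𝓘(ℝ, F) ∞ M]
  {g : LorentzianMetric E B} {i : M → B}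
  {S : ∀ p : M, Submodule ℝ (TangentSpace 𝓘(ℝ, F) p)}

theorem IsNullHypersurface.exists_eq_smul (hM : IsNullHypersurface g i S) {p : M}
    {n : TangentSpace 𝓘(ℝ, F) p} (hn : n ≠ 0) (hnr : n ∈ radical g i p)
    {v : TangentSpace 𝓘(ℝ, E) (i p)}
    (hv : ∀ w, g.inner (i p) v (mfderiv 𝓘(ℝ, F) 𝓘(ℝ, E) i p w) = 0) :
    ∃ c : ℝ, v = c • mfderiv 𝓘(ℝ, F) 𝓘(ℝ, E) i p n :=
  exists_eq_smul_of_perp_hyperplane (G := g.bilin (i p)) (fun _ h ↦ g.eq_zero h)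
    (d := (mfderiv 𝓘(ℝ, F) 𝓘(ℝ, E) i p).toLinearMap) (hM.immersion p) hM.codim_one
    (fun h ↦ hn (hM.immersion p (h.trans (map_zero _).symm))) hnr hv

/-- A vector orthogonal to the screen space and to a nonzero radical vector is orthogonal to the
whole tangent space. -/
theorem IsNullHypersurface.inner_eq_zero (hM : IsNullHypersurface g i S) {p : M}
    {n : TangentSpace 𝓘(ℝ, F) p} (hn : n ≠ 0) (hnr : n ∈ radical g i p)
    {v : TangentSpace 𝓘(ℝ, E) (i p)}
    (hvn : g.inner (i p) v (mfderiv 𝓘(ℝ, F) 𝓘(ℝ, E) i p n) = 0)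
    (hvS : ∀ w ∈ S p, g.inner (i p) v (mfderiv 𝓘(ℝ, F) 𝓘(ℝ, E) i p w) = 0)
    (w : TangentSpace 𝓘(ℝ, F) p) :
    g.inner (i p) v (mfderiv 𝓘(ℝ, F) 𝓘(ℝ, E) i p w) = 0 := by
  have hw : w ∈ S p ⊔ radical g i p := by
    rw [(hM.screen_compl p).sup_eq_top]
    trivial
  obtain ⟨s, hs, r, hr, rfl⟩ := Submodule.mem_sup.1 hw
  obtain ⟨c, hc⟩ := hM.exists_eq_smul hn hnr (v := mfderiv 𝓘(ℝ, F) 𝓘(ℝ, E) i p r) hr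
  rw [map_add, map_add, hvS s hs, hc, map_smul, hvn, smul_zero, add_zero]

/-- `n` is the vector at `p` that completes the radical vector `ξ` to a null frame. -/
structure IsNullPartner (g : LorentzianMetric E B) (i : M → B)
    (S : ∀ p : M, Submodule ℝ (TangentSpace 𝓘(ℝ, F) p)) (p : M) (ξ : TangentSpace 𝓘(ℝ, F) p)
    (n : TangentSpace 𝓘(ℝ, E) (i p)) : Prop where
  inner_ξ : g.inner (i p) (mfderiv 𝓘(ℝ, F) 𝓘(ℝ, E) i p ξ) n = 1
  inner_self : g.inner (i p) n n = 0
  inner_screen : ∀ X ∈ S p, g.inner (i p) n (mfderiv 𝓘(ℝ, F) 𝓘(ℝ, E) i p X) = 0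

theorem IsNullPartner.ne_zero {p : M} {ξ : TangentSpace 𝓘(ℝ, F) p}
    {n : TangentSpace 𝓘(ℝ, E) (i p)} (h : IsNullPartner g i S p ξ n) : ξ ≠ 0 := by
  rintro rfl
  simpa using h.inner_ξ

/-- The difference n - m is orthogonal to TM, so it is cξ; then 0 = ⟨n,n⟩ = 2c. Uniqueness allows
local partners to be glued. -/
theorem IsNullHypersurface.partner_unique (hM : IsNullHypersurface g i S) {p : M}
    {ξ : TangentSpace 𝓘(ℝ, F) p} (hξ : ξ ∈ radical g i p) {n m : TangentSpace 𝓘(ℝ, E) (i p)}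
    (hn : IsNullPartner g i S p ξ n) (hm : IsNullPartner g i S p ξ m) : n = m := by
  obtain ⟨c, hc⟩ := hM.exists_eq_smul hn.ne_zero hξ (v := n - m)
    (hM.inner_eq_zero hn.ne_zero hξ (by
      rw [g.symm, map_sub, hn.inner_ξ, hm.inner_ξ, sub_self]) fun w hw ↦ by
      rw [map_sub, sub_apply, hn.inner_screen w hw, hm.inner_screen w hw, sub_self])
  have hn' : n = m + c • mfderiv 𝓘(ℝ, F) 𝓘(ℝ, E) i p ξ := by rw [← hc]; abel
  have h1 := hn.inner_self
  have h2 : g.inner (i p) (mfderiv 𝓘(ℝ, F) 𝓘(ℝ, E) i p ξ) (mfderiv 𝓘(ℝ, F) 𝓘(ℝ, E) i p ξ) = 0 :=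
    hξ ξ
  rw [hn'] at h1
  simp only [map_add, map_smul, add_apply, smul_apply, smul_eq_mul, hm.inner_self, hm.inner_ξ,
    g.symm (i p) m (mfderiv 𝓘(ℝ, F) 𝓘(ℝ, E) i p ξ), h2] at h1
  have hc0 : c = 0 := by linarith
  rw [hn', hc0, zero_smul, add_zero]

theorem IsNullHypersurface.exists_local_partner (hM : IsNullHypersurface g i S)
    {ξ : ∀ p : M, TangentSpace 𝓘(ℝ, F) p}
    (hξ : ContMDiff 𝓘(ℝ, F) 𝓘(ℝ, F).tangent ∞ (fun p ↦ (⟨p, ξ p⟩ : TangentBundle 𝓘(ℝ, F) M)))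
    (hξ' : ∀ p, ξ p ≠ 0 ∧ ξ p ∈ radical g i p) (p : M) :
    ∃ N : ∀ x : M, TangentSpace 𝓘(ℝ, E) (i x), SmoothAlongAt (F := F) i N p ∧
      ∀ᶠ x in 𝓝 p, IsNullPartner g i S x (ξ x) (N x) := by
  obtain ⟨v, hv⟩ : ∃ v, g.inner (i p) (mfderiv 𝓘(ℝ, F) 𝓘(ℝ, E) i p (ξ p)) v ≠ 0 := by
    by_contra! h
    exact (hξ' p).1 (hM.immersion p ((g.eq_zero h).trans (map_zero _).symm))
  obtain ⟨V, hV, rfl⟩ := exists_smoothAlongAt (hM.smooth.contMDiffAt (x := p)) v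
  set ζ : ∀ x : M, TangentSpace 𝓘(ℝ, E) (i x) := fun x ↦ mfderiv 𝓘(ℝ, F) 𝓘(ℝ, E) i x (ξ x) with hζ
  have hζs : SmoothAlongAt (F := F) i ζ p := SmoothAlongAt.mfderiv hM.smooth hξ.contMDiffAt
  set V' : ∀ x : M, TangentSpace 𝓘(ℝ, E) (i x) := fun x ↦
    V x - mfderiv 𝓘(ℝ, F) 𝓘(ℝ, E) i x (screenPart g i S x (V x)) with hV'
  have hV's : SmoothAlongAt (F := F) i V' p := hV.sub (hM.smoothAlongAt_screenPart hV)
  have ht : ContMDiffAt 𝓘(ℝ, F) 𝓘(ℝ, ℝ) ∞ (fun x ↦ g.inner (i x) (ζ x) (V' x)) p :=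
    hζs.inner g hV's
  have heq : ∀ x, g.inner (i x) (ζ x) (V' x) = g.inner (i x) (ζ x) (V x) := by
    intro x
    have : g.inner (i x) (ζ x)
      (mfderiv 𝓘(ℝ, F) 𝓘(ℝ, E) i x (screenPart g i S x (V x))) = 0 := (hξ' x).2 _
    rw [hV', map_sub, this, sub_zero]
  have ht0 : g.inner (i p) (ζ p) (V' p) ≠ 0 := by rwa [heq]
  have hti : ContMDiffAt 𝓘(ℝ, F) 𝓘(ℝ, ℝ) ∞ (fun x ↦ (g.inner (i x) (ζ x) (V' x))⁻¹) p :=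
    ht.inv₀ ht0
  -- Scale V' to have product 1 with ζ, then subtract the multiple ⟨V',V'⟩ / (2⟨ζ,V'⟩²) of ζ that
  -- makes the result null.
  refine ⟨fun x ↦ (g.inner (i x) (ζ x) (V' x))⁻¹ • V' x -
    (g.inner (i x) (V' x) (V' x) * (1 / 2 * ((g.inner (i x) (ζ x) (V' x))⁻¹ *
      (g.inner (i x) (ζ x) (V' x))⁻¹))) • ζ x, (hV's.smul hti).sub (hζs.smul
        ((hV's.inner g hV's).mul (contMDiffAt_const.mul (hti.mul hti)))), ?_⟩
  filter_upwards [ht.continuousAt.eventually_ne ht0] with x hx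
  have hζζ : g.inner (i x) (ζ x) (ζ x) = 0 := (hξ' x).2 _
  have hsymm : g.inner (i x) (V' x) (ζ x) = g.inner (i x) (ζ x) (V' x) := g.symm _ _ _
  refine ⟨?_, ?_, fun X hX ↦ ?_⟩
  · change g.inner (i x) (ζ x) _ = 1
    simp only [map_sub, map_smul, smul_eq_mul, hζζ]
    field_simp
    ring
  · simp only [map_sub, map_smul, smul_eq_mul, hζζ, sub_apply, smul_apply, hsymm]
    field_simp
    ring
  · have h1 : g.inner (i x) (ζ x) (mfderiv 𝓘(ℝ, F) 𝓘(ℝ, E) i x X) = 0 := (hξ' x).2 _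
    have h2 : g.inner (i x) (V' x) (mfderiv 𝓘(ℝ, F) 𝓘(ℝ, E) i x X) = 0 :=
      (hM.screenPart_spec x (V x)).2 X hX
    simp only [map_sub, map_smul, smul_eq_mul, sub_apply, smul_apply, h1, h2]
    ring

/-- Partners are chosen pointwise; by uniqueness the choice agrees near each point with a smooth
local one. -/
theorem IsNullHypersurface.exists_nullFrame (hM : IsNullHypersurface g i S) :
    ∃ ξ N, IsNullFrame g i S ξ N := by
  obtain ⟨ξ, hξ, hξ'⟩ := hM.degenerate
  have hloc := hM.exists_local_partner hξ hξ'
  have hex : ∀ p, ∃ n, IsNullPartner g i S p (ξ p) n := fun p ↦ by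
    obtain ⟨N, -, hN⟩ := hloc p
    exact ⟨N p, hN.self_of_nhds⟩
  choose N hN using hex
  refine ⟨ξ, N, hξ, fun p ↦ (hξ' p).2, fun p ↦ ?_, fun p ↦ (hN p).inner_ξ,
    fun p ↦ (hN p).inner_self, fun p ↦ (hN p).inner_screen⟩
  obtain ⟨N', hN's, hN'⟩ := hloc p
  exact hN's.congr (hN'.mono fun x hx ↦ hM.partner_unique (hξ' x).2 (hN x) hx)

theorem IsNullFrame.partner {ξ : ∀ p : M, TangentSpace 𝓘(ℝ, F) p}
    {N : ∀ p : M, TangentSpace 𝓘(ℝ, E) (i p)} (h : IsNullFrame g i S ξ N) (p : M) :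
    IsNullPartner g i S p (ξ p) (N p) :=
  ⟨h.inner_ξ_N p, h.inner_N_N p, h.inner_N_screen p⟩

/-- The decomposition `⟨Z, Z⟩ = ⟨Z*, Z*⟩ + 2 ⟨Z, ξ⟩ ⟨Z, N⟩`. -/
theorem IsNullHypersurface.inner_self_eq (hM : IsNullHypersurface g i S)
    {ξ : ∀ p : M, TangentSpace 𝓘(ℝ, F) p} {N : ∀ p : M, TangentSpace 𝓘(ℝ, E) (i p)}
    (h : IsNullFrame g i S ξ N) (Z : ∀ p : M, TangentSpace 𝓘(ℝ, E) (i p)) (p : M) :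
    g.inner (i p) (Z p) (Z p) =
      induced g i p (screenPart g i S p (Z p)) (screenPart g i S p (Z p)) +
        2 * (innerTangent g i Z ξ p * innerAlong g i Z N p) := by
  obtain ⟨hs, hspec⟩ := hM.screenPart_spec p (Z p)
  set s := mfderiv 𝓘(ℝ, F) 𝓘(ℝ, E) i p (screenPart g i S p (Z p)) with hs'
  set ζ := mfderiv 𝓘(ℝ, F) 𝓘(ℝ, E) i p (ξ p) with hζ
  have hN := h.partner p
  have hζt : ∀ w, g.inner (i p) ζ (mfderiv 𝓘(ℝ, F) 𝓘(ℝ, E) i p w) = 0 := h.radical_ξ p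
  have e1 : g.inner (i p) ζ ζ = 0 := hζt _
  have e2 : g.inner (i p) ζ s = 0 := hζt _
  have e3 : g.inner (i p) (N p) s = 0 := hN.inner_screen _ hs
  have e4 : g.inner (i p) ζ (N p) = 1 := hN.inner_ξ
  have e5 : g.inner (i p) (N p) (N p) = 0 := hN.inner_self
  have e6 : g.inner (i p) (Z p - s) s = 0 := hspec _ hs
  have hsy := g.symm (i p)
  -- The error term of the decomposition is orthogonal to TM, hence a multiple of ζ; pairing it with
  -- N shows that the multiple is zero.
  obtain ⟨c, hc⟩ := hM.exists_eq_smul hN.ne_zero (h.radical_ξ p)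
    (v := Z p - s - g.inner (i p) (Z p) (N p) • ζ - g.inner (i p) (Z p) ζ • N p)
    (hM.inner_eq_zero hN.ne_zero (h.radical_ξ p) (by
      change g.inner (i p) _ ζ = 0
      simp only [map_sub, map_smul, sub_apply, smul_apply, smul_eq_mul, e1, hsy s ζ, e2,
        hsy (N p) ζ, e4]
      ring) fun w hw ↦ by
      have h1 := hspec w hw
      have h2 := hζt w
      have h3 := hN.inner_screen w hw
      simp only [map_sub, map_smul, sub_apply, smul_apply, smul_eq_mul, h2, h3] at h1 ⊢
      linarith)
  change _ = c • ζ at hc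
  have hc0 : c = 0 := by
    have h1 := congrArg (fun v ↦ g.inner (i p) v (N p)) hc
    simp only [map_sub, map_smul, sub_apply, smul_apply, smul_eq_mul, e4, e5, hsy s (N p),
      e3] at h1
    linarith
  rw [hc0, zero_smul] at hc
  have h1 := congrArg (fun v ↦ g.inner (i p) v (Z p)) hc
  simp only [map_sub, map_smul, sub_apply, smul_apply, smul_eq_mul, map_zero, zero_apply,
    hsy ζ (Z p), hsy (N p) (Z p), hsy s (Z p)] at h1
  rw [map_sub, sub_apply] at e6
  change _ = g.inner (i p) s s + 2 * (g.inner (i p) (Z p) ζ * g.inner (i p) (Z p) (N p))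
  linarith

end Null

/-! ### Rules for directional derivatives -/

section DirDeriv

variable {F : Type*} [NormedAddCommGroup F] [NormedSpace ℝ F]
  {M : Type*} [TopologicalSpace M] [ChartedSpace F M]
  {f h : M → ℝ} {p : M}

theorem dirDeriv_eq {L : F →L[ℝ] ℝ} (hf : ContMDiffAt 𝓘(ℝ, F) 𝓘(ℝ, ℝ) ∞ f p)
    (hL : HasFDerivAt (f ∘ (extChartAt 𝓘(ℝ, F) p).symm) L (extChartAt 𝓘(ℝ, F) p p))
    (u : TangentSpace 𝓘(ℝ, F) p) : dirDeriv f p u = L u := by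
  obtain ⟨L', h1, h2⟩ := exists_hasFDerivAt (hf.mdifferentiableAt (by simp))
  exact (h2 u).trans (congrArg (fun L : F →L[ℝ] ℝ ↦ L u) (h1.unique hL))

theorem dirDeriv_mul (hf : ContMDiffAt 𝓘(ℝ, F) 𝓘(ℝ, ℝ) ∞ f p)
    (hh : ContMDiffAt 𝓘(ℝ, F) 𝓘(ℝ, ℝ) ∞ h p) (u : TangentSpace 𝓘(ℝ, F) p) :
    dirDeriv (fun x ↦ f x * h x) p u = f p * dirDeriv h p u + h p * dirDeriv f p u := by
  obtain ⟨L, h1, h2⟩ := exists_hasFDerivAt (hf.mdifferentiableAt (by simp))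
  obtain ⟨K, h3, h4⟩ := exists_hasFDerivAt (hh.mdifferentiableAt (by simp))
  have := dirDeriv_eq (hf.mul hh) (h1.mul h3) u
  simp only [Function.comp_apply, extChartAt_to_inv] at this
  refine this.trans ?_
  rw [dirDeriv, dirDeriv, h2, h4]
  rfl

theorem dirDeriv_add_two_mul (hf : ContMDiffAt 𝓘(ℝ, F) 𝓘(ℝ, ℝ) ∞ f p)
    (hh : ContMDiffAt 𝓘(ℝ, F) 𝓘(ℝ, ℝ) ∞ h p) (u : TangentSpace 𝓘(ℝ, F) p) :
    dirDeriv (fun x ↦ f x + 2 * h x) p u = dirDeriv f p u + 2 * dirDeriv h p u := by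
  obtain ⟨L, h1, h2⟩ := exists_hasFDerivAt (hf.mdifferentiableAt (by simp))
  obtain ⟨K, h3, h4⟩ := exists_hasFDerivAt (hh.mdifferentiableAt (by simp))
  have := dirDeriv_eq (hf.add (contMDiffAt_const.mul hh)) (h1.add (h3.const_mul 2)) u
  refine this.trans ?_
  rw [dirDeriv, dirDeriv, h2, h4]
  rfl

end DirDeriv

/-! ### The equivalences -/

section Main

variable {E : Type*} [NormedAddCommGroup E] [NormedSpace ℝ E] [FiniteDimensional ℝ E]
  {B : Type*} [TopologicalSpace B] [ChartedSpace E B] [IsManifold 𝓘(ℝ, E) ∞ B]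
  {F : Type*} [NormedAddCommGroup F] [NormedSpace ℝ F] [FiniteDimensional ℝ F]
  {M : Type*} [TopologicalSpace M] [ChartedSpace F M] [IsManifold 𝓘(ℝ, F) ∞ M]
  {g : LorentzianMetric E B} {i : M → B}
  {S : ∀ p : M, Submodule ℝ (TangentSpace 𝓘(ℝ, F) p)}
  {Z : ∀ p : M, TangentSpace 𝓘(ℝ, E) (i p)}

theorem induced_symm (p : M) (u w : TangentSpace 𝓘(ℝ, F) p) :
    induced g i p u w = induced g i p w u :=
  g.symm _ _ _

theorem IsNullHypersurface.smooth_norm (hM : IsNullHypersurface g i S) {p : M}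
    (hZ : SmoothAlongAt (F := F) i Z p) :
    ContMDiffAt 𝓘(ℝ, F) 𝓘(ℝ, ℝ) ∞
      (fun x ↦ induced g i x (screenPart g i S x (Z x)) (screenPart g i S x (Z x))) p :=
  (hM.smoothAlongAt_screenPart hZ).inner g (hM.smoothAlongAt_screenPart hZ)

/-- `⟨Z, Z⟩` is constant in the screen directions orthogonal to the screen component of `Z`. -/
theorem IsNullHypersurface.dirDeriv_inner_self (hM : IsNullHypersurface g i S)
    (hZ : IsClosedConformal (F := F) g i Z) {p : M} {X : TangentSpace 𝓘(ℝ, F) p} (hX : X ∈ S p)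
    (h : induced g i p X (screenPart g i S p (Z p)) = 0) :
    dirDeriv (fun x ↦ g.inner (i x) (Z x) (Z x)) p X = 0 := by
  obtain ⟨hZs, φ, -, hφ⟩ := hZ
  rw [mfderiv_inner_eq_nabla g (hZs p) (hZs p), hφ, g.symm (i p) (φ p • _) (Z p), map_smul,
    ← hM.induced_screenPart (Z p) hX, induced_symm, h, smul_zero, add_zero]

theorem IsNullFrame.smooth_innerTangent (hM : IsNullHypersurface g i S)
    {ξ : ∀ p : M, TangentSpace 𝓘(ℝ, F) p} {N : ∀ p : M, TangentSpace 𝓘(ℝ, E) (i p)}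
    (h : IsNullFrame g i S ξ N) (hZ : SmoothAlong (F := F) i Z) :
    ContMDiff 𝓘(ℝ, F) 𝓘(ℝ, ℝ) ∞ (innerTangent g i Z ξ) := fun p ↦
  SmoothAlongAt.inner g (hZ p) (SmoothAlongAt.mfderiv hM.smooth h.smooth_ξ.contMDiffAt)

theorem IsNullFrame.smooth_innerAlong
    {ξ : ∀ p : M, TangentSpace 𝓘(ℝ, F) p} {N : ∀ p : M, TangentSpace 𝓘(ℝ, E) (i p)}
    (h : IsNullFrame g i S ξ N) (hZ : SmoothAlong (F := F) i Z) :
    ContMDiff 𝓘(ℝ, F) 𝓘(ℝ, ℝ) ∞ (innerAlong g i Z N) := fun p ↦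
  SmoothAlongAt.inner g (hZ p) (h.smooth_N p)

theorem IsNullHypersurface.normConstant_iff (hM : IsNullHypersurface g i S)
    (hZ : IsClosedConformal (F := F) g i Z) {ξ : ∀ p : M, TangentSpace 𝓘(ℝ, F) p}
    {N : ∀ p : M, TangentSpace 𝓘(ℝ, E) (i p)} (h : IsNullFrame g i S ξ N) :
    NormConstant g i S Z ↔
      ConstantAcross g i S Z (fun p ↦ innerTangent g i Z ξ p * innerAlong g i Z N p) := by
  refine forall₄_congr fun p X hX hXZ ↦ ?_
  change dirDeriv _ p X = 0 ↔ dirDeriv _ p X = 0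
  have h1 := hM.dirDeriv_inner_self hZ hX hXZ
  simp_rw [hM.inner_self_eq h Z] at h1
  rw [dirDeriv_add_two_mul (h := fun x ↦ innerTangent g i Z ξ x * innerAlong g i Z N x)
    (hM.smooth_norm (hZ.1 p))
    ((h.smooth_innerTangent hM hZ.1 p).mul (h.smooth_innerAlong hZ.1 p))] at h1
  constructor <;> intro h2 <;> rw [h2] at h1 <;> linarith

theorem IsNullHypersurface.normConstant_iff_productConstant (hM : IsNullHypersurface g i S)
    (hZ : IsClosedConformal (F := F) g i Z) : NormConstant g i S Z ↔ ProductConstant g i S Z := by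
  constructor
  · exact fun h ξ N hf ↦ (hM.normConstant_iff hZ hf).1 h
  · obtain ⟨ξ, N, hf⟩ := hM.exists_nullFrame
    exact fun h ↦ (hM.normConstant_iff hZ hf).2 (h ξ N hf)

/-- The derivative of `⟨Z*, Z*⟩` in the screen directions orthogonal to `Z*` in terms of the shape
operator. -/
theorem IsNullHypersurface.dirDeriv_norm (hM : IsNullHypersurface g i S) (hS : IsIntegrable S)
    (hZ : IsClosedConformal (F := F) g i Z) {p : M} {X : TangentSpace 𝓘(ℝ, F) p} (hX : X ∈ S p)
    (h : induced g i p X (screenPart g i S p (Z p)) = 0) :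
    dirDeriv (fun x ↦ induced g i x (screenPart g i S x (Z x)) (screenPart g i S x (Z x))) p X =
      2 * induced g i p
        (shapeOperator g i S (perpPart g i S Z) p (screenPart g i S p (Z p))) X := by
  obtain ⟨hZs, φ, -, hφ⟩ := hZ
  have hW := hM.smoothAlongAt_screenPart (hZs p)
  have hWmem := (hM.screenPart_spec p (Z p)).1
  have hperp : SmoothAlongAt (F := F) i (perpPart g i S Z) p := SmoothAlongAt.sub (hZs p) hW
  have h1 : dirDeriv (fun x ↦ induced g i x (screenPart g i S x (Z x))
      (screenPart g i S x (Z x))) p X = _ := mfderiv_inner_eq_nabla g hW hW X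
  have h2 := inner_nabla_symm_of_isIntegrable g hM.smooth hS hperp
    (fun x w hw ↦ (hM.screenPart_spec x (Z x)).2 w hw) hX hWmem
  have h3 : g.nabla i (perpPart g i S Z) p X = g.nabla i Z p X - g.nabla i
      (fun x ↦ mfderiv 𝓘(ℝ, F) 𝓘(ℝ, E) i x (screenPart g i S x (Z x))) p X :=
    nabla_sub g (hZs p) hW X
  have h4 : induced g i p (shapeOperator g i S (perpPart g i S Z) p
      (screenPart g i S p (Z p))) X = -g.inner (i p) (g.nabla i (perpPart g i S Z) p
        (screenPart g i S p (Z p))) (mfderiv 𝓘(ℝ, F) 𝓘(ℝ, E) i p X) := by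
    rw [← hM.induced_screenPart _ hX]
    simp [induced, shapeOperator]
  -- Symmetry moves the derivative from the direction Z* to X; then ∇_X Z = φX drops out because X
  -- is orthogonal to Z*.
  rw [h4, ← h2, h3, hφ]
  rw [induced] at h
  simp only [map_sub, map_smul, sub_apply, smul_apply, h, smul_zero]
  rw [h1, g.symm (i p) (mfderiv 𝓘(ℝ, F) 𝓘(ℝ, E) i p (screenPart g i S p (Z p)))]
  ring

theorem IsNullHypersurface.principal_iff_normConstant (hM : IsNullHypersurface g i S)
    (hS : IsIntegrable S) (hZ : IsClosedConformal (F := F) g i Z) :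
    HasCanonicalPrincipalDirection g i S Z ↔ NormConstant g i S Z := by
  refine forall_congr' fun p ↦ ⟨?_, fun h ↦ ?_⟩
  · rintro ⟨c, hc⟩ X hX hXZ
    change dirDeriv _ p X = 0
    rw [induced_symm] at hXZ
    rw [hM.dirDeriv_norm hS hZ hX (by rwa [induced_symm]), hc]
    simp only [induced] at hXZ ⊢
    rw [map_smul, map_smul, smul_apply, hXZ, smul_zero, mul_zero]
  · refine exists_eq_smul_of_perp (G := inducedBilin g i p) (S := S p)
      (fun v hv h ↦ hM.eq_zero hv h) ((S p).neg_mem (hM.screenPart_spec p _).1)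
      (hM.screenPart_spec p _).1 fun X hX hXZ ↦ ?_
    have hXZ' : induced g i p X (screenPart g i S p (Z p)) = 0 := (induced_symm _ _ _).trans hXZ
    have h1 : dirDeriv _ p X = 0 := h X hX hXZ'
    rw [hM.dirDeriv_norm hS hZ hX hXZ'] at h1
    exact (mul_eq_zero.1 h1).resolve_left two_ne_zero

/-- The Leibniz rule settles the given frame only; passing through `NormConstant`, which involves no
frame, reaches all the others. -/
theorem FrameConstant.productConstant (hM : IsNullHypersurface g i S)
    (hZ : IsClosedConformal (F := F) g i Z) (h : FrameConstant g i S Z) :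
    ProductConstant g i S Z := by
  obtain ⟨ξ, N, hf, h1, h2⟩ := h
  refine (hM.normConstant_iff_productConstant hZ).1 ((hM.normConstant_iff hZ hf).2 ?_)
  intro p X hX hXZ
  have h1' : dirDeriv (innerTangent g i Z ξ) p X = 0 := h1 p X hX hXZ
  have h2' : dirDeriv (innerAlong g i Z N) p X = 0 := h2 p X hX hXZ
  change dirDeriv _ p X = 0
  rw [dirDeriv_mul (hf.smooth_innerTangent hM hZ.1 p) (hf.smooth_innerAlong hZ.1 p), h1', h2',
    mul_zero, mul_zero, add_zero]

theorem IsNullFrame.rescale {ξ : ∀ p : M, TangentSpace 𝓘(ℝ, F) p}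
    {N : ∀ p : M, TangentSpace 𝓘(ℝ, E) (i p)} (h : IsNullFrame g i S ξ N) {r s : M → ℝ}
    (hr : ContMDiff 𝓘(ℝ, F) 𝓘(ℝ, ℝ) ∞ r) (hs : ContMDiff 𝓘(ℝ, F) 𝓘(ℝ, ℝ) ∞ s)
    (hrs : ∀ p, r p * s p = 1) :
    IsNullFrame g i S (fun p ↦ r p • ξ p) (fun p ↦ s p • N p) where
  -- A vector field on M is a field along the identity map.
  smooth_ξ := fun p ↦ SmoothAlongAt.smul (i := id) (V := ξ) (hr p) (h.smooth_ξ p)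
  radical_ξ p := (radical g i p).smul_mem _ (h.radical_ξ p)
  smooth_N := fun p ↦ SmoothAlongAt.smul (hs p) (h.smooth_N p)
  inner_ξ_N p := by
    simp only [map_smul, smul_apply, h.inner_ξ_N p, smul_eq_mul]
    linarith [hrs p]
  inner_N_N p := by simp [h.inner_N_N p]
  inner_N_screen p X hX := by simp [h.inner_N_screen p X hX]

theorem constantAcross_one : ConstantAcross g i S Z (fun _ ↦ 1) := by
  intro p X _ _
  rw [mfderiv_const]
  rfl

theorem IsNullFrame.frameConstant (hM : IsNullHypersurface g i S)
    (hZ : IsClosedConformal (F := F) g i Z) {ξ : ∀ p : M, TangentSpace 𝓘(ℝ, F) p}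
    {N : ∀ p : M, TangentSpace 𝓘(ℝ, E) (i p)} (h : IsNullFrame g i S ξ N)
    (h0 : (∀ p, innerTangent g i Z ξ p ≠ 0) ∨ (∀ p, innerAlong g i Z N p ≠ 0))
    (hp : ProductConstant g i S Z) : FrameConstant g i S Z := by
  have hT := h.smooth_innerTangent hM hZ.1
  have hA := h.smooth_innerAlong hZ.1
  have hprod := hp ξ N h
  have key (r s : M → ℝ) : innerTangent g i Z (fun p ↦ r p • ξ p) =
      (fun p ↦ r p * innerTangent g i Z ξ p) ∧ innerAlong g i Z (fun p ↦ s p • N p) =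
      (fun p ↦ s p * innerAlong g i Z N p) :=
    ⟨funext fun p ↦ by simp [innerTangent], funext fun p ↦ by simp [innerAlong]⟩
  rcases h0 with h0 | h0
  · refine ⟨_, _, h.rescale (fun p ↦ (hT p).inv₀ (h0 p)) hT fun p ↦ inv_mul_cancel₀ (h0 p), ?_, ?_⟩
    · rw [(key _ (innerTangent g i Z ξ)).1]
      simp only [inv_mul_cancel₀ (h0 _)]
      exact constantAcross_one
    · rwa [(key (innerTangent g i Z ξ) _).2]
  · refine ⟨_, _, h.rescale hA (fun p ↦ (hA p).inv₀ (h0 p)) fun p ↦ mul_inv_cancel₀ (h0 p), ?_, ?_⟩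
    · rw [(key _ (innerAlong g i Z N)).1]
      simpa only [mul_comm] using hprod
    · rw [(key (innerAlong g i Z N) _).2]
      simp only [inv_mul_cancel₀ (h0 _)]
      exact constantAcross_one

end Main

end NullHyp

end

open NullHyp in
theorem mainTheorem6
    {E : Type*} [NormedAddCommGroup E] [NormedSpace ℝ E] [FiniteDimensional ℝ E]
    {B : Type*} [TopologicalSpace B] [ChartedSpace E B] [IsManifold 𝓘(ℝ, E) ∞ B]
    {F : Type*} [NormedAddCommGroup F] [NormedSpace ℝ F] [FiniteDimensional ℝ F]
    {M : Type*} [TopologicalSpace M] [ChartedSpace F M] [IsManifold 𝓘(ℝ, F) ∞ M]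
    (g : LorentzianMetric E B) (i : M → B)
    (S : ∀ p : M, Submodule ℝ (TangentSpace 𝓘(ℝ, F) p))
    (hM : IsNullHypersurface g i S) (hS : IsIntegrable S)
    (Z : ∀ p : M, TangentSpace 𝓘(ℝ, E) (i p)) (hZ : IsClosedConformal (F := F) g i Z) :
    List.TFAE
      [HasCanonicalPrincipalDirection g i S Z, ProductConstant g i S Z, NormConstant g i S Z] ∧
    (FrameConstant g i S Z → ProductConstant g i S Z) ∧
    ((∃ ξ N, IsNullFrame g i S ξ N ∧
        ((∀ p, innerTangent g i Z ξ p ≠ 0) ∨ (∀ p, innerAlong g i Z N p ≠ 0))) →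
      List.TFAE
        [HasCanonicalPrincipalDirection g i S Z, ProductConstant g i S Z,
          FrameConstant g i S Z, NormConstant g i S Z]) := by
  have h1 := hM.principal_iff_normConstant hS hZ
  have h2 := hM.normConstant_iff_productConstant hZ
  have h3 : FrameConstant g i S Z → ProductConstant g i S Z :=
    FrameConstant.productConstant hM hZ
  refine ⟨?_, h3, ?_⟩
  · tfae_have 1 ↔ 3 := h1
    tfae_have 3 ↔ 2 := h2
    tfae_finish
  · rintro ⟨ξ, N, hf, h0⟩
    tfae_have 1 ↔ 4 := h1
    tfae_have 4 ↔ 2 := h2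
    tfae_have 3 → 2 := h3
    tfae_have 2 → 3 := hf.frameConstant hM hZ h0
    tfae_finish
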